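/- **Theorem 2 (Asymptotic Normality).** *Data.* Let $(T_i,L_i,\tilde L_i,S_i,Y_i,Z_i)$, $i=1,2,\dots$, be the variables of a sample of units, with $T_i,S_i\in\{0,1\}$, real-valued $L_i$ (true concept) and $\tilde L_i$ (human label, observed if $S_i=1$), text $Y_i$ and controls $Z_i$; the records $O_i=(T_i,\tilde L_i,S_i,Y_i,Z_i)$ are i.i.d. Assume: $L_i=g_L(Y_i)$ for a deterministic function $g_L$; $\tilde L_i=L_i$ almost surely; $(T_i,Y_i,Z_i)$ is independent of $S_i$ and $P(S_i=1)>0$; and there is a representation $W_i=f(Y_i)\in\mathbb R^p$ with $Y_i\perp\!\!\!\perp (L_i,T_i)\mid W_i,Z_i$. *Target and influence function.* Fix $t\in\{0,1\}$. Let $\Psi_t=E\big[E[L_i\mid T_i=t,Z_i]\big]$, $\mu(W_i,Z_i)=E[\tilde L_i\mid W_i,Z_i]$, $\rho_t(W_i,Z_i)=P(T_i=t\mid W_i,Z_i)$, $\pi_t(Z_i)=P(T_i=t\mid Z_i)$, $\bar m_t(Z_i)=E[\mu(f(Y_i),Z_i)\mid Z_i,T_i=t]$, and $$\psi_t(O_i;f,\rho_t,\pi_t,\mu,\bar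 m_t,\Psi_t)=\frac{1\{S_i=1\}}{P(S_i=1)}\frac{\rho_t(f(Y_i),Z_i)}{\pi_t(Z_i)}\big(\tilde L_i-\mu(f(Y_i),Z_i)\big)+\frac{1\{T_i=t\}}{\pi_t(Z_i)}\big(\mu(f(Y_i),Z_i)-\bar m_t(Z_i)\big)+\bar m_t(Z_i)-\Psi_t .$$ *Estimator.* Fix $K\ge1$. For every sample size $n$ divisible by $K$, let the observations be partitioned into $K$ folds of size $n/K$, possibly at random; for each fold $k$ let $\hat f^{(-k)},\hat\rho_t^{(-k)},\hat\pi_t^{(-k)},\hat\mu^{(-k)},\hat{\bar m}_t^{(-k)}$ be estimates computed by any (jointly measurable) rule from the observations outside fold $k$ and, possibly, auxiliary randomness; the partition and the auxiliary randomness are independent of the sample. Let $\hat\Psi_t$ solve $$\frac1n\sum_{k=1}^K\ \sum_{i\in\text{fold }k}\psi_t\big(O_i;\hat f^{(-k)},\hat\rho_t^{(-k)},\hat\pi_t^{(-k)},\hat\mu^{(-k)},\hat{\bar m}_t^{(-k)},\hat\Psi_t\big)=0 .$$ *Regularity conditions.* For functions $a,b$ of $(Y,Z)$ let $\|a-b\|=E\big[|a(Y,Z)-b(Y,Z)|^2\big]^{1/2}$,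 where $(Y,Z)$ belongs to a new unit, that is, the expectation is taken with the training data of the estimates held fixed. Assume, for all $n$ and $k$ (the superscript $(-k)$ is omitted): (a) $E[|\tilde L_i|^2]<\infty$; (b) there is $c_2\in(0,1/2]$ with $c_2\le\pi_t(Z)\le1-c_2$, $c_2\le\hat\pi_t(Z)\le1-c_2$ and $0\le\hat\rho_t(\hat f(Y),Z)\le1$ almost surely; (c), (d) there is a sequence $\delta_n\to0$ such that for each $k$, with probability tending to one as $n\to\infty$, the errors $\|\hat\rho_t\circ\hat f-\rho_t\circ f\|$, $\|\hat\mu\circ\hat f-\mu\circ f\|$, $\|\hat\pi_t-\pi_t\|$, $\|\hat{\bar m}_t-\bar m_t\|$ are all at most $\delta_n$ (where $\rho\circ f$ denotes $(y,z)\mapsto\rho(f(y),z)$), and $$\|\hat\rho_t\circ\hat f-\rho_t\circ f\|\cdot\|\hat\mu\circ\hat f-\mu\circ f\|\le n^{-1/2}\delta_n,\qquad \|\hat\pi_t-\pi_t\|\cdot\|\hat{\bar m}_t-\bar m_t\|\le n^{-1/2}\delta_n .$$ *Conclusion.* Let $\sigma^2=E\big[\psi_t(O_i;f,\rho_t,\pi_t,\mu,\bar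 m_t,\Psi_t)^2\big]$ and suppose $\sigma^2>0$. Then, as $n\to\infty$ along the multiples of $K$, $$\frac{\sqrt n\,(\hat\Psi_t-\Psi_t)}{\sigma}\ \xrightarrow{d}\ \mathcal N(0,1).$$ -/

import Mathlib

open MeasureTheory ProbabilityTheory Filter Topology

namespace SRI

/-- The record `(T, L̃, S, Y, Z)` of one unit: binary predictor `T`, human label `L̃`, annotation
indicator `S` (the label is observed iff `S = 1`), text `Y`, controls `Z`. -/
abbrev Obs (𝒴 𝒵 : Type*) := Fin 2 × ℝ × Fin 2 × 𝒴 × 𝒵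

/-- The random variables of the sampled units `i = 0, 1, 2, …`. `L i` is the latent true concept,
`Lt i` the human label `L̃ i`. -/
structure Sample (Ω 𝒴 𝒵 : Type*) where
  T : ℕ → Ω → Fin 2
  L : ℕ → Ω → ℝ
  Lt : ℕ → Ω → ℝ
  S : ℕ → Ω → Fin 2
  Y : ℕ → Ω → 𝒴
  Z : ℕ → Ω → 𝒵

/-- The record of unit `i`. -/
def Sample.obs {Ω 𝒴 𝒵 : Type*} (X : Sample Ω 𝒴 𝒵) (i : ℕ) (ω : Ω) : Obs 𝒴 𝒵 :=
  (X.T i ω, X.Lt i ω, X.S i ω, X.Y i ω, X.Z i ω)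

/-- The records of the first `n` units. -/
def Sample.data {Ω 𝒴 𝒵 : Type*} (X : Sample Ω 𝒴 𝒵) (n : ℕ) (ω : Ω) : Fin n → Obs 𝒴 𝒵 :=
  fun i => X.obs i ω

/-- `X` and `X'` are conditionally independent given `V`:
`P(X ∈ s, X' ∈ t | V) = P(X ∈ s | V) P(X' ∈ t | V)` a.s. for all measurable `s`, `t`. -/
def CondIndepGiven {Ω α β γ : Type*} [MeasurableSpace Ω] [MeasurableSpace α] [MeasurableSpace β]
    [mγ : MeasurableSpace γ] (P : Measure Ω) (X : Ω → α) (X' : Ω → β) (V : Ω → γ) : Prop :=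
  ∀ s t, MeasurableSet s → MeasurableSet t →
    P⟦X ⁻¹' s ∩ X' ⁻¹' t | mγ.comap V⟧ =ᵐ[P]
      fun ω => (P⟦X ⁻¹' s | mγ.comap V⟧) ω * (P⟦X' ⁻¹' t | mγ.comap V⟧) ω

/-- `r` is (a version of) the regression function `v ↦ E_ν[A | V = v]`. -/
def IsRegression {Ω α : Type*} [MeasurableSpace Ω] [mα : MeasurableSpace α] (ν : Measure Ω)
    (A : Ω → ℝ) (V : Ω → α) (r : α → ℝ) : Prop :=
  Measurable r ∧ (fun ω => r (V ω)) =ᵐ[ν] ν[A | mα.comap V]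

/-- The functions that enter the efficient influence function at a fixed level `t`: representation
`f`, surrogacy score `ρ_t`, propensity score `π_t`, outcome model `μ` and `m̄_t`. -/
structure Nuisance (p : ℕ) (𝒴 𝒵 : Type*) where
  f : 𝒴 → Fin p → ℝ
  ρ : (Fin p → ℝ) × 𝒵 → ℝ
  π : 𝒵 → ℝ
  μ : (Fin p → ℝ) × 𝒵 → ℝ
  mbar : 𝒵 → ℝ

/-- `(y, z) ↦ ρ_t(f(y), z)`. -/
def Nuisance.score {p : ℕ} {𝒴 𝒵 : Type*} (η : Nuisance p 𝒴 𝒵) (y : 𝒴) (z : 𝒵) : ℝ :=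
  η.ρ (η.f y, z)

/-- `(y, z) ↦ μ(f(y), z)`. -/
def Nuisance.outcome {p : ℕ} {𝒴 𝒵 : Type*} (η : Nuisance p 𝒴 𝒵) (y : 𝒴) (z : 𝒵) : ℝ :=
  η.μ (η.f y, z)

/-- The efficient influence function `ψ_t` at the observation `(T, L̃, S, Y, Z)`, with nuisance
functions `η` and parameter value `Ψ`; `q` stands for `P(S = 1)`. -/
noncomputable def eif {p : ℕ} {𝒴 𝒵 : Type*} (t : Fin 2) (q : ℝ) (η : Nuisance p 𝒴 𝒵) (Ψ : ℝ) :
    Obs 𝒴 𝒵 → ℝ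
  | (T, Lt, S, y, z) =>
    (if S = 1 then 1 else 0) / q * (η.score y z / η.π z) * (Lt - η.outcome y z)
      + (if T = t then 1 else 0) / η.π z * (η.outcome y z - η.mbar z)
      + η.mbar z - Ψ

variable {Ω 𝒴 𝒵 𝒰 : Type*} [MeasurableSpace Ω] [MeasurableSpace 𝒴] [MeasurableSpace 𝒵]
  [MeasurableSpace 𝒰]

/-- The records are measurable, independent and identically distributed. -/
structure Sample.IsIID (X : Sample Ω 𝒴 𝒵) (P : Measure Ω) : Prop where
  measurable_obs : ∀ i, Measurable (X.obs i)
  indep : iIndepFun X.obs P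
  identDistrib : ∀ i, IdentDistrib (X.obs i) (X.obs 0) P P

/-- The target `Ψ_t = E[E[L | T = t, Z]]`. The inner expectation is the conditional expectation
given `Z` under the conditional law `P(· | T = t)`. -/
noncomputable def target (P : Measure Ω) (X : Sample Ω 𝒴 𝒵) (t : Fin 2) : ℝ :=
  ∫ ω, ((P[|X.T 0 ⁻¹' {t}])[X.L 0 | MeasurableSpace.comap (X.Z 0) inferInstance]) ω ∂P

/-- `η` consists of the population quantities: `f` is a sufficient representation,
`Y ⫫ (L, T) | f(Y), Z`, and with `W = f(Y)`, `μ(W, Z) = E[L̃ | W, Z]`, `ρ_t(W, Z) = P(T = t | W, Z)`,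
`π_t(Z) = P(T = t | Z)`, `m̄_t(Z) = E[μ(W, Z) | Z, T = t]`. -/
structure IsPopulationNuisance {p : ℕ} (P : Measure Ω) (X : Sample Ω 𝒴 𝒵) (t : Fin 2)
    (η : Nuisance p 𝒴 𝒵) : Prop where
  measurable_f : Measurable η.f
  sufficient : CondIndepGiven P (X.Y 0) (fun ω => (X.L 0 ω, X.T 0 ω))
    (fun ω => (η.f (X.Y 0 ω), X.Z 0 ω))
  outcome : IsRegression P (X.Lt 0) (fun ω => (η.f (X.Y 0 ω), X.Z 0 ω)) η.μ
  score : IsRegression P (fun ω => if X.T 0 ω = t then 1 else 0)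
    (fun ω => (η.f (X.Y 0 ω), X.Z 0 ω)) η.ρ
  propensity : IsRegression P (fun ω => if X.T 0 ω = t then 1 else 0) (X.Z 0) η.π
  mbar : IsRegression (P[|X.T 0 ⁻¹' {t}]) (fun ω => η.outcome (X.Y 0 ω) (X.Z 0 ω)) (X.Z 0) η.mbar

/-- The asymptotic variance `σ² = E[ψ_t²]`. -/
noncomputable def asymVar {p : ℕ} (P : Measure Ω) (X : Sample Ω 𝒴 𝒵) (t : Fin 2)
    (η : Nuisance p 𝒴 𝒵) : ℝ :=
  ∫ ω, eif t (P.real {ω | X.S 0 ω = 1}) η (target P X t) (X.obs 0 ω) ^ 2 ∂P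

/-- A `K`-fold cross-fitting scheme for the sample sizes `n = K * m`, `m = 0, 1, 2, …`.
`fold m u i` is the fold of observation `i`, where `u` is a realisation of all auxiliary randomness
(the random partition, random splits of the training data, random initialisation, …). Every fold
has `m` elements. `fit m k u d` are the nuisance functions estimated for fold `k`, by an arbitrary
(jointly measurable) rule that does not use the observations in fold `k`. -/
structure CrossFit (K p : ℕ) (𝒰 𝒴 𝒵 : Type*) [MeasurableSpace 𝒰] [MeasurableSpace 𝒴]
    [MeasurableSpace 𝒵] where
  fold : (m : ℕ) → 𝒰 → Fin (K * m) → Fin K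
  measurable_fold : ∀ m i, Measurable fun u => fold m u i
  card_fold : ∀ m u k, (Finset.univ.filter fun i => fold m u i = k).card = m
  fit : (m : ℕ) → Fin K → 𝒰 → (Fin (K * m) → Obs 𝒴 𝒵) → Nuisance p 𝒴 𝒵
  fit_out_of_fold : ∀ m k u (d d' : Fin (K * m) → Obs 𝒴 𝒵),
    (∀ i, fold m u i ≠ k → d i = d' i) → fit m k u d = fit m k u d'
  measurable_score : ∀ m k, Measurable fun x : 𝒰 × (Fin (K * m) → Obs 𝒴 𝒵) × 𝒴 × 𝒵 =>
    (fit m k x.1 x.2.1).score x.2.2.1 x.2.2.2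
  measurable_outcome : ∀ m k, Measurable fun x : 𝒰 × (Fin (K * m) → Obs 𝒴 𝒵) × 𝒴 × 𝒵 =>
    (fit m k x.1 x.2.1).outcome x.2.2.1 x.2.2.2
  measurable_propensity : ∀ m k, Measurable fun x : 𝒰 × (Fin (K * m) → Obs 𝒴 𝒵) × 𝒵 =>
    (fit m k x.1 x.2.1).π x.2.2
  measurable_mbar : ∀ m k, Measurable fun x : 𝒰 × (Fin (K * m) → Obs 𝒴 𝒵) × 𝒵 =>
    (fit m k x.1 x.2.1).mbar x.2.2

/-- The left-hand side at `Ψ` of the estimating equation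
`(1/n) ∑_k ∑_{i in fold k} ψ_t(O_i; η̂^{(-k)}, Ψ) = 0` with `n = K * m`. -/
noncomputable def CrossFit.estimatingFn {K p : ℕ} (C : CrossFit K p 𝒰 𝒴 𝒵) (t : Fin 2) (q : ℝ)
    (m : ℕ) (u : 𝒰) (d : Fin (K * m) → Obs 𝒴 𝒵) (Ψ : ℝ) : ℝ :=
  1 / ((K * m : ℕ) : ℝ) * ∑ k : Fin K, ∑ i ∈ Finset.univ.filter fun i => C.fold m u i = k,
    eif t q (C.fit m k u d) Ψ (d i)

/-- The `L²` distance `E[|a(Y, Z) - b(Y, Z)|²]^{1/2}`, where `(Y, Z)` has the population law. With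
an estimated `a` this is the error over a new unit, with the training data held fixed. -/
noncomputable def l2dist (P : Measure Ω) (X : Sample Ω 𝒴 𝒵) (a b : 𝒴 → 𝒵 → ℝ) : ENNReal :=
  eLpNorm (fun ω => a (X.Y 0 ω) (X.Z 0 ω) - b (X.Y 0 ω) (X.Z 0 ω)) 2 P

/-- The estimated nuisance functions `ηh` are within `δ` of `η` in `L²`, and for the two products
of errors `√n * product ≤ δ`. -/
structure Accurate {p : ℕ} (P : Measure Ω) (X : Sample Ω 𝒴 𝒵) (η ηh : Nuisance p 𝒴 𝒵)
    (n : ℕ) (δ : ℝ) : Prop where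
  score : l2dist P X ηh.score η.score ≤ ENNReal.ofReal δ
  outcome : l2dist P X ηh.outcome η.outcome ≤ ENNReal.ofReal δ
  propensity : l2dist P X (fun _ => ηh.π) (fun _ => η.π) ≤ ENNReal.ofReal δ
  mbar : l2dist P X (fun _ => ηh.mbar) (fun _ => η.mbar) ≤ ENNReal.ofReal δ
  score_mul_outcome : ENNReal.ofReal √n *
    (l2dist P X ηh.score η.score * l2dist P X ηh.outcome η.outcome) ≤ ENNReal.ofReal δ
  propensity_mul_mbar : ENNReal.ofReal √n *
    (l2dist P X (fun _ => ηh.π) (fun _ => η.π) * l2dist P X (fun _ => ηh.mbar) (fun _ => η.mbar))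
      ≤ ENNReal.ofReal δ

end SRI

/-!
Write `V = (f(Y), Z)` and let `ψ(η)` be the influence function at the nuisance functions `η`. Since
`L = gL(Y)` and `Y ⫫ (L, T) | V`, the variable `L` is conditionally independent of itself given `V`
and is therefore a function of `V`, namely `μ(V)` (`CondIndepGiven.regression_eq`). The same
conditional independence makes `ρ_t(V)` the propensity score given the whole text and the controls,
`P(T = t | Y, Z)` (`CondIndepGiven.condExp_prodMk`). Overlap turns statements within the arm
`T = t` into statements under the population law: `m̄_t(Z)` is square integrable and has mean `Ψ_t`.
These facts are collected in `IsIdentified`.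

With them the mean of `ψ(η̂)` for fixed `η̂` is
`E[-(ρ̂ - ρ)(μ̂ - μ) / π̂ + (π̂ - π)(m̂ - m̄) / π̂]` (`IsIdentified.integral_eif`). It vanishes at the
true `η`, and the product rates make it `o(n^{-1/2})`. The `L²` distance of `ψ(η̂)` from `ψ(η)` tends
to zero as well (`IsIdentified.eLpNorm_eif_sub_le`); here the error `π̂ - π` meets the unbounded
factor `μ - m̄_t`, which is split at a large level, using that `|π̂ - π| ≤ 1`.

By cross-fitting, given the auxiliary randomness and the observations outside a fold, the sum of
`ψ(η̂) - ψ(η)` over the fold is a sum of i.i.d. variables, with second moment at most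
`m E[(ψ(η̂) - ψ(η))²] + m² (E[ψ(η̂) - ψ(η)])²`. Chebyshev's inequality makes it `o(√n)` in
probability (`prod_measure_sum_fold_le`, `IsIdentified.tendsto_measure_fold`). The estimating
equation is affine in the parameter, so that `√n (Ψ̂ - Ψ) / σ` differs from the standardised sum of
the i.i.d. variables `ψ(η)` by a term that tends to zero in probability, and the central limit
theorem and Slutsky's theorem conclude.
-/

namespace SRI

/-! ### Conditional independence and regression functions -/

section Regression

/-- The σ-algebra generated by a random variable. -/
local notation "σ[" V "]" => MeasurableSpace.comap V inferInstance

variable {Ω α β γ : Type*} [MeasurableSpace Ω] [mα : MeasurableSpace α] [mβ : MeasurableSpace β]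
  [mγ : MeasurableSpace γ]

lemma IsRegression.memLp {ν : Measure Ω} [IsFiniteMeasure ν] {A : Ω → ℝ} {V : Ω → α} {r : α → ℝ}
    (h : IsRegression ν A V r) {q : ENNReal} (hq : 1 ≤ q) (hA : MemLp A q ν) :
    MemLp (fun ω => r (V ω)) q ν :=
  (memLp_congr_ae h.2).mpr (hA.condExp hq)

lemma IsRegression.integrable {ν : Measure Ω} {A : Ω → ℝ} {V : Ω → α}
    {r : α → ℝ} (h : IsRegression ν A V r) : Integrable (fun ω => r (V ω)) ν :=
  integrable_condExp.congr h.2.symm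

lemma IsRegression.setIntegral_preimage {ν : Measure Ω} [IsFiniteMeasure ν] {A : Ω → ℝ}
    {V : Ω → α} {r : α → ℝ} (h : IsRegression ν A V r) (hV : Measurable V) (hA : Integrable A ν)
    {s : Set α} (hs : MeasurableSet s) :
    ∫ ω in V ⁻¹' s, r (V ω) ∂ν = ∫ ω in V ⁻¹' s, A ω ∂ν := by
  rw [← setIntegral_condExp hV.comap_le hA ⟨s, hs, rfl⟩]
  exact setIntegral_congr_ae (hV hs) (h.2.mono fun ω hω _ => hω)

/-- The defining property of a regression function, with a weight `g(V)`:
`E[g(V) A] = E[g(V) r(V)]`. -/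
lemma IsRegression.integral_mul {ν : Measure Ω} [IsFiniteMeasure ν] {A : Ω → ℝ} {V : Ω → α}
    {r : α → ℝ} (h : IsRegression ν A V r) (hV : Measurable V) (hA : Integrable A ν)
    {g : α → ℝ} (hg : Measurable g) (hgA : Integrable (fun ω => g (V ω) * A ω) ν) :
    ∫ ω, g (V ω) * A ω ∂ν = ∫ ω, g (V ω) * r (V ω) ∂ν := by
  have hgV : StronglyMeasurable[mα.comap V] fun ω => g (V ω) :=
    (hg.comp (comap_measurable V)).stronglyMeasurable
  rw [← integral_condExp hV.comap_le]
  refine integral_congr_ae ((condExp_mul_of_stronglyMeasurable_left hgV hgA hA).trans ?_)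
  filter_upwards [h.2] with ω hω
  simp [hω]

lemma integrable_indicator_one {P : Measure Ω} [IsFiniteMeasure P] {s : Set Ω}
    (hs : MeasurableSet s) : Integrable (s.indicator fun _ => (1 : ℝ)) P :=
  (integrable_const 1).indicator hs

/-- Under `Y ⫫ X | f(Y), Z`, the representation `f(Y)` carries all the information of `Y` about `X`
that is not already in `Z`: `P(X ∈ B | Y, Z) = P(X ∈ B | f(Y), Z)`. -/
lemma CondIndepGiven.condExp_prodMk {δ : Type*} [mδ : MeasurableSpace δ] {P : Measure Ω}
    [IsProbabilityMeasure P] {Y : Ω → α}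
    {Z : Ω → β} {X : Ω → γ} {f : α → δ} (hY : Measurable Y) (hZ : Measurable Z)
    (hX : Measurable X) (hf : Measurable f)
    (h : CondIndepGiven P Y X fun ω => (f (Y ω), Z ω)) {B : Set γ} (hB : MeasurableSet B) :
    P⟦X ⁻¹' B | σ[fun ω => (f (Y ω), Z ω)]⟧ =ᵐ[P]
      P⟦X ⁻¹' B | σ[fun ω => (Y ω, Z ω)]⟧ := by
  set V : Ω → δ × β := fun ω => (f (Y ω), Z ω)
  set W : Ω → α × β := fun ω => (Y ω, Z ω)
  have hYZ : Measurable W := hY.prodMk hZ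
  have hV : Measurable V := (hf.comp hY).prodMk hZ
  have hVm : σ[V] ≤ ‹MeasurableSpace Ω› := hV.comap_le
  have hVW : σ[V] ≤ σ[W] := by
    rintro _ ⟨s, hs, rfl⟩
    exact ⟨(fun x : α × β => (f x.1, x.2)) ⁻¹' s,
      ((hf.comp measurable_fst).prodMk measurable_snd) hs, rfl⟩
  set c := P⟦X ⁻¹' B | σ[V]⟧
  have hint : Integrable ((X ⁻¹' B).indicator fun _ => (1 : ℝ)) P := integrable_indicator_one (hX hB)
  have hcint : Integrable c P := integrable_condExp
  -- it suffices to compare the integrals over the rectangles `{Y ∈ s, Z ∈ r}`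
  have key : ∀ C : Set (α × β), MeasurableSet C →
      ∫ ω in W ⁻¹' C, c ω ∂P =
        ∫ ω in W ⁻¹' C, (X ⁻¹' B).indicator (fun _ => (1 : ℝ)) ω ∂P := by
    refine MeasurableSpace.induction_on_inter generateFrom_prod.symm isPiSystem_prod ?_ ?_ ?_ ?_
    · simp
    · rintro _ ⟨s, hs, r, hr, rfl⟩
      have hs' : MeasurableSet s := hs
      have hr' : MeasurableSet r := hr
      have hZr : MeasurableSet[σ[V]] (Z ⁻¹' r) := ⟨Prod.snd ⁻¹' r, measurable_snd hr', rfl⟩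
      have hpre : W ⁻¹' (s ×ˢ r) = Z ⁻¹' r ∩ Y ⁻¹' s := by
        ext ω; simp [W, and_comm]
      have e1 : ∀ g : Ω → ℝ, ∫ ω in Z ⁻¹' r ∩ Y ⁻¹' s, g ω ∂P =
          ∫ ω in Z ⁻¹' r, (Y ⁻¹' s).indicator g ω ∂P := fun g =>
        (setIntegral_indicator (hY hs')).symm
      rw [hpre, e1, e1]
      have hcs : Integrable ((Y ⁻¹' s).indicator c) P := hcint.indicator (hY hs')
      have hBs : Integrable ((Y ⁻¹' s).indicator ((X ⁻¹' B).indicator fun _ => (1 : ℝ))) P :=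
        hint.indicator (hY hs')
      rw [← setIntegral_condExp hVm hcs hZr, ← setIntegral_condExp hVm hBs hZr]
      refine setIntegral_congr_ae (hZ hr') ?_
      have h1 : P[(Y ⁻¹' s).indicator c | σ[V]] =ᵐ[P]
          fun ω => (P⟦Y ⁻¹' s | σ[V]⟧) ω * c ω := by
        have : (Y ⁻¹' s).indicator c = c * (Y ⁻¹' s).indicator fun _ => (1 : ℝ) := by
          ext ω; by_cases hω : ω ∈ Y ⁻¹' s <;> simp [hω]
        rw [this]
        refine (condExp_mul_of_stronglyMeasurable_left stronglyMeasurable_condExp (this ▸ hcs)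
          (integrable_indicator_one (hY hs'))).trans (.of_forall fun ω => ?_)
        exact mul_comm _ _
      have h2 : (Y ⁻¹' s).indicator ((X ⁻¹' B).indicator fun _ => (1 : ℝ)) =
          (Y ⁻¹' s ∩ X ⁻¹' B).indicator fun _ => (1 : ℝ) := by
        rw [Set.indicator_indicator]
      rw [h2]
      filter_upwards [h1, h s B hs' hB] with ω h1 h2 _
      rw [h1, h2]
    · intro C hC ih
      rw [Set.preimage_compl]
      have a := integral_add_compl (hYZ hC) hcint
      have b := integral_add_compl (hYZ hC) hint
      have e : ∫ ω, c ω ∂P = ∫ ω, (X ⁻¹' B).indicator (fun _ => (1 : ℝ)) ω ∂P :=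
        integral_condExp hVm
      linarith
    · intro C hd hC ih
      rw [Set.preimage_iUnion,
        integral_iUnion (fun i => hYZ (hC i)) (fun i j hij => (hd hij).preimage _) hcint.integrableOn,
        integral_iUnion (fun i => hYZ (hC i)) (fun i j hij => (hd hij).preimage _) hint.integrableOn]
      exact tsum_congr ih
  refine ae_eq_condExp_of_forall_setIntegral_eq hYZ.comap_le hint
    (fun _ _ _ => hcint.integrableOn) ?_
    (stronglyMeasurable_condExp.mono hVW).aestronglyMeasurable
  rintro _ ⟨C, hC, rfl⟩ _
  exact key C hC

/-- If `L = g(Y)` and `Y ⫫ (L, T) | f(Y), Z`, then `L` is conditionally independent of itself, hence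
it is a function of `(f(Y), Z)`, namely its own regression function. -/
lemma CondIndepGiven.regression_eq {δ : Type*} [mδ : MeasurableSpace δ] {P : Measure Ω}
    [IsProbabilityMeasure P] {Y : Ω → α} {Z : Ω → β} {T : Ω → γ} {f : α → δ} {g : α → ℝ}
    (hY : Measurable Y) (hZ : Measurable Z) (hT : Measurable T) (hf : Measurable f)
    (hg : Measurable g)
    (h : CondIndepGiven P Y (fun ω => (g (Y ω), T ω)) fun ω => (f (Y ω), Z ω))
    (hL : Integrable (fun ω => g (Y ω)) P) {r : δ × β → ℝ}
    (hr : IsRegression P (fun ω => g (Y ω)) (fun ω => (f (Y ω), Z ω)) r) :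
    ∀ᵐ ω ∂P, g (Y ω) = r (f (Y ω), Z ω) := by
  set V : Ω → δ × β := fun ω => (f (Y ω), Z ω)
  set W : Ω → α × β := fun ω => (Y ω, Z ω)
  have hYZ : Measurable W := hY.prodMk hZ
  have hV : Measurable V := (hf.comp hY).prodMk hZ
  have hVm : σ[V] ≤ ‹MeasurableSpace Ω› := hV.comap_le
  set L : Ω → ℝ := fun ω => g (Y ω)
  set m : Ω → ℝ := fun ω => r (f (Y ω), Z ω)
  have hmV' : Measurable[σ[V]] m := hr.1.comp (comap_measurable _)
  have hmint : Integrable m P := hr.integrable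
  -- events in terms of `L` have conditional probability zero or one
  have zero_one : ∀ B : Set ℝ, MeasurableSet B →
      P⟦L ⁻¹' B | σ[V]⟧ =ᵐ[P] (L ⁻¹' B).indicator fun _ => (1 : ℝ) := by
    intro B hB
    have := h.condExp_prodMk hY hZ (X := fun ω => (g (Y ω), T ω)) ((hg.comp hY).prodMk hT) hf
      (B := B ×ˢ Set.univ)
      (hB.prod MeasurableSet.univ)
    have hpre : (fun ω => (g (Y ω), T ω)) ⁻¹' (B ×ˢ Set.univ) = L ⁻¹' B := by ext; simp [L]
    rw [hpre] at this
    refine this.trans (Eq.eventuallyEq ?_)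
    refine condExp_of_stronglyMeasurable hYZ.comap_le ?_ (integrable_indicator_one ((hg.comp hY) hB))
    exact stronglyMeasurable_const.indicator
      ⟨Prod.fst ⁻¹' (g ⁻¹' B), measurable_fst (hg hB), rfl⟩
  -- therefore they have the same integrals against `L` and against its regression function
  have key : ∀ B : Set ℝ, MeasurableSet B → ∀ D : Set Ω, MeasurableSet[σ[V]] D →
      ∫ ω in D ∩ L ⁻¹' B, L ω ∂P = ∫ ω in D ∩ L ⁻¹' B, m ω ∂P := by
    intro B hB D hD
    have hLB : MeasurableSet (L ⁻¹' B) := (hg.comp hY) hB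
    rw [← setIntegral_indicator hLB, ← setIntegral_indicator hLB]
    have hLi : Integrable ((L ⁻¹' B).indicator L) P := hL.indicator hLB
    set c := P⟦L ⁻¹' B | σ[V]⟧
    have e : ∀ a : Ω → ℝ, (L ⁻¹' B).indicator a =ᵐ[P] c * a := fun a => by
      filter_upwards [zero_one B hB] with ω hω
      rw [Pi.mul_apply, show c ω = _ from hω]
      by_cases hω' : ω ∈ L ⁻¹' B <;> simp [hω']
    have e2 : P[c * L | σ[V]] =ᵐ[P] c * m :=
      (condExp_mul_of_stronglyMeasurable_left stronglyMeasurable_condExp (hLi.congr (e L)) hL).trans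
        ((Filter.EventuallyEq.refl _ c).mul hr.2.symm)
    calc ∫ ω in D, (L ⁻¹' B).indicator L ω ∂P = ∫ ω in D, (c * L) ω ∂P :=
          setIntegral_congr_ae (hVm _ hD) ((e L).mono fun _ h _ => h)
      _ = ∫ ω in D, P[c * L | σ[V]] ω ∂P := (setIntegral_condExp hVm (hLi.congr (e L)) hD).symm
      _ = ∫ ω in D, (c * m) ω ∂P := setIntegral_congr_ae (hVm _ hD) (e2.mono fun _ h _ => h)
      _ = ∫ ω in D, (L ⁻¹' B).indicator m ω ∂P :=
          setIntegral_congr_ae (hVm _ hD) ((e m).mono fun _ h _ => h.symm)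
  -- a rational between `L` and its regression function would give a strict inequality of integrals
  have le : ∀ q : ℚ, ∀ᵐ ω ∂P, ¬ (L ω ≤ q ∧ q < m ω) := by
    intro q
    have hD : MeasurableSet[σ[V]] (m ⁻¹' Set.Ioi (q : ℝ)) := hmV' measurableSet_Ioi
    have hE := key (Set.Iic (q : ℝ)) measurableSet_Iic _ hD
    have hms : MeasurableSet (m ⁻¹' Set.Ioi (q : ℝ) ∩ L ⁻¹' Set.Iic (q : ℝ)) :=
      (hVm _ hD).inter ((hg.comp hY) measurableSet_Iic)
    have h0 : ∫ ω in m ⁻¹' Set.Ioi (q : ℝ) ∩ L ⁻¹' Set.Iic (q : ℝ), (m - L) ω ∂P = 0 := by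
      rw [integral_sub' hmint.integrableOn hL.integrableOn, hE, sub_self]
    rw [setIntegral_eq_zero_iff_of_nonneg_ae ?_ (hmint.sub hL).integrableOn] at h0
    · have := (ae_restrict_iff' hms).mp h0
      filter_upwards [this] with ω hω hq
      have := hω ⟨hq.2, hq.1⟩
      simp only [Pi.zero_apply, Pi.sub_apply] at this
      linarith [hq.1, hq.2]
    · refine (ae_restrict_iff' hms).mpr (.of_forall fun ω hω => ?_)
      have h1 : (q : ℝ) < m ω := hω.1
      have h2 : L ω ≤ q := hω.2
      simp only [Pi.zero_apply, Pi.sub_apply]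
      linarith
  have ge : ∀ q : ℚ, ∀ᵐ ω ∂P, ¬ (m ω < q ∧ q ≤ L ω) := by
    intro q
    have hD : MeasurableSet[σ[V]] (m ⁻¹' Set.Iio (q : ℝ)) := hmV' measurableSet_Iio
    have hE := key (Set.Ici (q : ℝ)) measurableSet_Ici _ hD
    have hms : MeasurableSet (m ⁻¹' Set.Iio (q : ℝ) ∩ L ⁻¹' Set.Ici (q : ℝ)) :=
      (hVm _ hD).inter ((hg.comp hY) measurableSet_Ici)
    have h0 : ∫ ω in m ⁻¹' Set.Iio (q : ℝ) ∩ L ⁻¹' Set.Ici (q : ℝ), (L - m) ω ∂P = 0 := by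
      rw [integral_sub' hL.integrableOn hmint.integrableOn, hE, sub_self]
    rw [setIntegral_eq_zero_iff_of_nonneg_ae ?_ (hL.sub hmint).integrableOn] at h0
    · have := (ae_restrict_iff' hms).mp h0
      filter_upwards [this] with ω hω hq
      have := hω ⟨hq.1, hq.2⟩
      simp only [Pi.zero_apply, Pi.sub_apply] at this
      linarith [hq.1, hq.2]
    · refine (ae_restrict_iff' hms).mpr (.of_forall fun ω hω => ?_)
      have h1 : m ω < (q : ℝ) := hω.1
      have h2 : q ≤ L ω := hω.2
      simp only [Pi.zero_apply, Pi.sub_apply]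
      linarith
  filter_upwards [ae_all_iff.mpr le, ae_all_iff.mpr ge] with ω h1 h2
  refine le_antisymm ?_ ?_
  · by_contra! hlt
    obtain ⟨q, hq1, hq2⟩ := exists_rat_btwn hlt
    exact h2 q ⟨hq1, hq2.le⟩
  · by_contra! hlt
    obtain ⟨q, hq1, hq2⟩ := exists_rat_btwn hlt
    exact h1 q ⟨hq1.le, hq2⟩

end Regression

/-! ### Identification from a single unit -/

lemma ite_eq_indicator_preimage {Ω β : Type*} [DecidableEq β] (T : Ω → β) (t : β) :
    (fun ω => if T ω = t then (1 : ℝ) else 0) = (T ⁻¹' {t}).indicator fun _ => (1 : ℝ) := by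
  ext ω; by_cases h : T ω = t <;> simp [h]

section Identification

variable {Ω 𝒴 𝒵 : Type*} [MeasurableSpace Ω] [MeasurableSpace 𝒴] [MeasurableSpace 𝒵]

section Overlap

variable {α : Type*} [mα : MeasurableSpace α]

lemma measureReal_inter_eq_cond {P : Measure Ω} [IsProbabilityMeasure P] {s : Set Ω}
    (hs : MeasurableSet s) (h0 : P s ≠ 0) (u : Set Ω) :
    P.real (s ∩ u) = P.real s * (P[|s]).real u := by
  rw [measureReal_def, measureReal_def, measureReal_def, cond_apply hs, ENNReal.toReal_mul,
    ENNReal.toReal_inv, mul_inv_cancel_left₀]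
  exact (ENNReal.toReal_pos h0 (measure_ne_top P s)).ne'

/-- A lower bound on the propensity score makes the arm nonempty. -/
lemma measure_ne_zero_of_le_propensity {P : Measure Ω} [IsProbabilityMeasure P] {s : Set Ω}
    (hs : MeasurableSet s) {Z : Ω → α} (hZ : Measurable Z) {π : α → ℝ}
    (hπ : IsRegression P (s.indicator fun _ => (1 : ℝ)) Z π) {c : ℝ} (hc : 0 < c)
    (hle : ∀ᵐ ω ∂P, c ≤ π (Z ω)) : P s ≠ 0 := by
  intro h0
  have h1 := hπ.setIntegral_preimage hZ (integrable_indicator_one hs) MeasurableSet.univ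
  have h2 : ∫ ω, s.indicator (fun _ => (1 : ℝ)) ω ∂P = 0 := by
    rw [integral_indicator_const _ hs, measureReal_def, h0]; simp
  have h3 : ∫ _, c ∂P ≤ ∫ ω, π (Z ω) ∂P :=
    integral_mono_ae (integrable_const c) hπ.integrable hle
  simp only [Set.preimage_univ, Measure.restrict_univ, integral_const, probReal_univ,
    one_smul] at h1 h3
  linarith

/-- Overlap: when the propensity score is at least `c`, the law of `Z` is dominated by `c⁻¹` times
its law within the arm. -/
lemma map_le_smul_map_cond {P : Measure Ω} [IsProbabilityMeasure P] {s : Set Ω}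
    (hs : MeasurableSet s) {Z : Ω → α} (hZ : Measurable Z) {π : α → ℝ}
    (hπ : IsRegression P (s.indicator fun _ => (1 : ℝ)) Z π) {c : ℝ} (hc : 0 < c)
    (hle : ∀ᵐ ω ∂P, c ≤ π (Z ω)) :
    P.map Z ≤ ENNReal.ofReal c⁻¹ • (P[|s]).map Z := by
  have h0 := measure_ne_zero_of_le_propensity hs hZ hπ hc hle
  have : IsProbabilityMeasure (P[|s]) := cond_isProbabilityMeasure h0
  refine Measure.le_iff.mpr fun B hB => ?_
  rw [Measure.smul_apply, Measure.map_apply hZ hB, Measure.map_apply hZ hB, smul_eq_mul,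
    ← ofReal_measureReal (μ := P), ← ofReal_measureReal (μ := P[|s]),
    ← ENNReal.ofReal_mul (by positivity)]
  refine ENNReal.ofReal_le_ofReal ?_
  rw [inv_mul_eq_div, le_div_iff₀ hc]
  have h1 := hπ.setIntegral_preimage hZ (integrable_indicator_one hs) hB
  rw [setIntegral_indicator hs, setIntegral_const, smul_eq_mul, mul_one, Set.inter_comm,
    measureReal_inter_eq_cond hs h0] at h1
  have h2 : ∫ _ in Z ⁻¹' B, c ∂P ≤ ∫ ω in Z ⁻¹' B, π (Z ω) ∂P :=
    integral_mono_ae (integrable_const c) hπ.integrable.integrableOn (ae_restrict_of_ae hle)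
  rw [setIntegral_const, smul_eq_mul] at h2
  have h3 : P.real s ≤ 1 := measureReal_le_one
  nlinarith [measureReal_nonneg (μ := P[|s]) (s := Z ⁻¹' B)]

/-- A vanishing conditional mean given `s` is a moment condition under the unconditional law. -/
lemma integral_indicator_one_mul_eq_zero {P : Measure Ω} [IsProbabilityMeasure P] {s : Set Ω}
    (hs : MeasurableSet s) (h0 : P s ≠ 0) {F : Ω → ℝ} (hF : ∫ ω, F ω ∂(P[|s]) = 0) :
    ∫ ω, s.indicator (fun _ => (1 : ℝ)) ω * F ω ∂P = 0 := by
  have e : (fun ω => s.indicator (fun _ => (1 : ℝ)) ω * F ω) = s.indicator F := by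
    ext ω; by_cases hω : ω ∈ s <;> simp [hω]
  rw [e, integral_indicator hs]
  rw [ProbabilityTheory.cond, integral_smul_measure, smul_eq_zero] at hF
  refine hF.resolve_left ?_
  rw [ENNReal.toReal_inv]
  exact inv_ne_zero (ENNReal.toReal_pos h0 (measure_ne_top P s)).ne'

end Overlap

/-- Nuisance functions at which the influence function is square integrable: the components are
measurable, the outcome functions are square integrable, the surrogacy score is a probability and
the propensity score is bounded away from zero. Both the population quantities and accurate
estimates of them satisfy this. -/
structure IsAdmissible {p : ℕ} (P : Measure Ω) (X : Sample Ω 𝒴 𝒵) (c : ℝ)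
    (η : Nuisance p 𝒴 𝒵) : Prop where
  measurable_score : Measurable fun x : 𝒴 × 𝒵 => η.score x.1 x.2
  measurable_outcome : Measurable fun x : 𝒴 × 𝒵 => η.outcome x.1 x.2
  measurable_propensity : Measurable η.π
  measurable_mbar : Measurable η.mbar
  memLp_outcome : MemLp (fun ω => η.outcome (X.Y 0 ω) (X.Z 0 ω)) 2 P
  memLp_mbar : MemLp (fun ω => η.mbar (X.Z 0 ω)) 2 P
  score_mem : ∀ᵐ ω ∂P, η.score (X.Y 0 ω) (X.Z 0 ω) ∈ Set.Icc (0 : ℝ) 1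
  propensity_mem : ∀ᵐ ω ∂P, η.π (X.Z 0 ω) ∈ Set.Icc c 1

/-- The consequences of the sampling and sufficiency assumptions for a single unit. The label is a
function of `(f(Y), Z)`, the surrogacy score is the propensity score given the full text `Y`, and
`m̄_t` is characterised by moment conditions under the unconditional law. -/
structure IsIdentified {p : ℕ} (P : Measure Ω) (X : Sample Ω 𝒴 𝒵) (t : Fin 2) (c : ℝ)
    (η : Nuisance p 𝒴 𝒵) : Prop where
  measurable_T : Measurable (X.T 0)
  measurable_S : Measurable (X.S 0)
  measurable_Y : Measurable (X.Y 0)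
  measurable_Z : Measurable (X.Z 0)
  c_pos : 0 < c
  annotated_pos : 0 < P.real {ω | X.S 0 ω = 1}
  indep : IndepFun (X.S 0) (fun ω => (X.Y 0 ω, X.Z 0 ω)) P
  admissible : IsAdmissible P X c η
  label : ∀ᵐ ω ∂P, X.Lt 0 ω = η.outcome (X.Y 0 ω) (X.Z 0 ω)
  score : IsRegression P (fun ω => if X.T 0 ω = t then 1 else 0) (fun ω => (X.Y 0 ω, X.Z 0 ω))
    fun x => η.score x.1 x.2
  propensity : IsRegression P (fun ω => if X.T 0 ω = t then 1 else 0) (X.Z 0) η.π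
  mbar : ∀ g : 𝒵 → ℝ, Measurable g → (∃ b, ∀ᵐ ω ∂P, |g (X.Z 0 ω)| ≤ b) →
    ∫ ω, (if X.T 0 ω = t then 1 else 0) *
      (g (X.Z 0 ω) * (η.outcome (X.Y 0 ω) (X.Z 0 ω) - η.mbar (X.Z 0 ω))) ∂P = 0
  target_eq : target P X t = ∫ ω, η.mbar (X.Z 0 ω) ∂P

lemma IsRegression.mem_Icc_of_indicator {α : Type*} [MeasurableSpace α] {P : Measure Ω}
    [IsProbabilityMeasure P] {s : Set Ω} (hs : MeasurableSet s) {V : Ω → α} {r : α → ℝ}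
    (h : IsRegression P (s.indicator fun _ => (1 : ℝ)) V r) (hV : Measurable V) :
    ∀ᵐ ω ∂P, r (V ω) ∈ Set.Icc (0 : ℝ) 1 := by
  have h1 := condExp_nonneg (μ := P) (m := MeasurableSpace.comap V inferInstance)
    (f := s.indicator fun _ => (1 : ℝ)) (.of_forall fun ω => Set.indicator_nonneg (by simp) ω)
  have h2 := condExp_mono (μ := P) (m := MeasurableSpace.comap V inferInstance)
    (integrable_indicator_one hs) (integrable_const (1 : ℝ))
    (.of_forall fun ω => Set.indicator_le_self' (by simp) ω)
  rw [condExp_const hV.comap_le] at h2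
  filter_upwards [h.2, h1, h2] with ω h0 h1 h2
  rw [h0]
  exact ⟨h1, h2⟩

theorem IsPopulationNuisance.isIdentified {P : Measure Ω} [IsProbabilityMeasure P]
    {X : Sample Ω 𝒴 𝒵} (hiid : X.IsIID P)
    {gL : 𝒴 → ℝ} (hgL : Measurable gL) (hL : ∀ ω, X.L 0 ω = gL (X.Y 0 ω))
    (hperfect : ∀ᵐ ω ∂P, X.Lt 0 ω = X.L 0 ω)
    (hS : IndepFun (fun ω => (X.T 0 ω, X.Y 0 ω, X.Z 0 ω)) (X.S 0) P)
    (hS_pos : 0 < P {ω | X.S 0 ω = 1})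
    {t : Fin 2} {p : ℕ} {η : Nuisance p 𝒴 𝒵} (hη : IsPopulationNuisance P X t η)
    (hmom : MemLp (X.Lt 0) 2 P) {c : ℝ} (hc : 0 < c)
    (hpos : ∀ᵐ ω ∂P, η.π (X.Z 0 ω) ∈ Set.Icc c (1 - c)) :
    IsIdentified P X t c η := by
  have hobs := hiid.measurable_obs 0
  have hT : Measurable (X.T 0) := measurable_fst.comp hobs
  have hS' : Measurable (X.S 0) := (measurable_fst.comp (measurable_snd.comp measurable_snd)).comp hobs
  have hY : Measurable (X.Y 0) :=
    (measurable_fst.comp (measurable_snd.comp (measurable_snd.comp measurable_snd))).comp hobs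
  have hZ : Measurable (X.Z 0) :=
    (measurable_snd.comp (measurable_snd.comp (measurable_snd.comp measurable_snd))).comp hobs
  have hfV : Measurable fun x : 𝒴 × 𝒵 => (η.f x.1, x.2) :=
    (hη.measurable_f.comp measurable_fst).prodMk measurable_snd
  have hLeq : X.L 0 = fun ω => gL (X.Y 0 ω) := funext hL
  rw [hLeq] at hperfect
  have hperfect' : X.Lt 0 =ᵐ[P] fun ω => gL (X.Y 0 ω) := hperfect
  have hLint : Integrable (fun ω => gL (X.Y 0 ω)) P :=
    (hmom.integrable one_le_two).congr hperfect
  have hreg : IsRegression P (fun ω => gL (X.Y 0 ω)) (fun ω => (η.f (X.Y 0 ω), X.Z 0 ω)) η.μ :=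
    ⟨hη.outcome.1, hη.outcome.2.trans (condExp_congr_ae hperfect')⟩
  have hsuff := hη.sufficient
  rw [hLeq] at hsuff
  have hLμ : ∀ᵐ ω ∂P, gL (X.Y 0 ω) = η.outcome (X.Y 0 ω) (X.Z 0 ω) :=
    hsuff.regression_eq hY hZ hT hη.measurable_f hgL hLint hreg
  have hTt : MeasurableSet (X.T 0 ⁻¹' {t}) := hT (measurableSet_singleton t)
  have hite := ite_eq_indicator_preimage (X.T 0) t
  have hprop := hη.propensity
  rw [hite] at hprop
  have hle : ∀ᵐ ω ∂P, c ≤ η.π (X.Z 0 ω) := hpos.mono fun ω h => h.1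
  have h0 : P (X.T 0 ⁻¹' {t}) ≠ 0 := measure_ne_zero_of_le_propensity hTt hZ hprop hc hle
  have hdom := map_le_smul_map_cond hTt hZ hprop hc hle
  set Q := P[|X.T 0 ⁻¹' {t}]
  have : IsProbabilityMeasure Q := cond_isProbabilityMeasure h0
  have hQP : Q ≪ P := cond_absolutelyContinuous
  have hout : MemLp (fun ω => η.outcome (X.Y 0 ω) (X.Z 0 ω)) 2 P :=
    hη.outcome.memLp one_le_two hmom
  have houtQ : MemLp (fun ω => η.outcome (X.Y 0 ω) (X.Z 0 ω)) 2 Q :=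
    (hout.restrict _).smul_measure (ENNReal.inv_ne_top.mpr h0)
  have hmbarQ : MemLp (fun ω => η.mbar (X.Z 0 ω)) 2 Q := hη.mbar.memLp one_le_two houtQ
  have hmbar : MemLp (fun ω => η.mbar (X.Z 0 ω)) 2 P := by
    have h1 : MemLp η.mbar 2 (Q.map (X.Z 0)) :=
      (memLp_map_measure_iff hη.mbar.1.aestronglyMeasurable hZ.aemeasurable).mpr hmbarQ
    have h2 : MemLp η.mbar 2 (P.map (X.Z 0)) :=
      h1.of_measure_le_smul ENNReal.ofReal_ne_top hdom
    exact (memLp_map_measure_iff hη.mbar.1.aestronglyMeasurable hZ.aemeasurable).mp h2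
  have hscore : IsRegression P (fun ω => if X.T 0 ω = t then 1 else 0)
      (fun ω => (X.Y 0 ω, X.Z 0 ω)) fun x => η.score x.1 x.2 := by
    refine ⟨hη.score.1.comp hfV, ?_⟩
    have h1 := hsuff.condExp_prodMk hY hZ (X := fun ω => (gL (X.Y 0 ω), X.T 0 ω))
      ((hgL.comp hY).prodMk hT) hη.measurable_f (B := Set.univ ×ˢ {t})
      (MeasurableSet.univ.prod (measurableSet_singleton t))
    have hpre : (fun ω => (gL (X.Y 0 ω), X.T 0 ω)) ⁻¹' (Set.univ ×ˢ {t}) = X.T 0 ⁻¹' {t} := by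
      ext ω; simp
    rw [hpre, ← hite] at h1
    exact hη.score.2.trans h1
  refine
    { measurable_T := hT
      measurable_S := hS'
      measurable_Y := hY
      measurable_Z := hZ
      c_pos := hc
      annotated_pos := ENNReal.toReal_pos hS_pos.ne' (measure_ne_top P _)
      indep := (hS.comp measurable_snd measurable_id).symm
      admissible :=
        { measurable_score := hscore.1
          measurable_outcome := hη.outcome.1.comp hfV
          measurable_propensity := hprop.1
          measurable_mbar := hη.mbar.1
          memLp_outcome := hout
          memLp_mbar := hmbar
          score_mem := ?_
          propensity_mem := hpos.mono fun ω h => ⟨h.1, h.2.trans (by linarith)⟩ }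
      label := by filter_upwards [hperfect, hLμ] with ω h1 h2 using h1.trans h2
      score := hscore
      propensity := hη.propensity
      mbar := ?_
      target_eq := ?_ }
  · rw [hite] at hscore
    exact hscore.mem_Icc_of_indicator hTt (hY.prodMk hZ)
  · rintro g hg ⟨b, hb⟩
    have e := fun ω => congrFun hite ω
    simp_rw [e]
    refine integral_indicator_one_mul_eq_zero hTt h0 ?_
    have hbQ : ∀ᵐ ω ∂Q, ‖g (X.Z 0 ω)‖ ≤ b := hQP.ae_le hb
    have hgm : AEStronglyMeasurable (fun ω => g (X.Z 0 ω)) Q :=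
      (hg.comp hZ).aestronglyMeasurable
    have i1 := (houtQ.integrable one_le_two).bdd_mul hgm hbQ
    have i2 := (hmbarQ.integrable one_le_two).bdd_mul hgm hbQ
    simp_rw [mul_sub]
    rw [integral_sub i1 i2, hη.mbar.integral_mul hZ (houtQ.integrable one_le_two) hg i1, sub_self]
  · -- both sides are functions of `Z` that agree almost surely within the arm
    have h1 : Q[X.L 0 | MeasurableSpace.comap (X.Z 0) inferInstance] =ᵐ[Q]
        fun ω => η.mbar (X.Z 0 ω) := by
      refine (condExp_congr_ae ?_).trans hη.mbar.2.symm
      rw [hLeq]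
      exact hQP.ae_le hLμ
    have hms : MeasurableSet[MeasurableSpace.comap (X.Z 0) inferInstance]
        {ω | Q[X.L 0 | MeasurableSpace.comap (X.Z 0) inferInstance] ω = η.mbar (X.Z 0 ω)} :=
      @measurableSet_eq_fun _ _ (MeasurableSpace.comap (X.Z 0) inferInstance) _ _ _ _
        stronglyMeasurable_condExp.measurable (hη.mbar.1.comp (comap_measurable _))
    obtain ⟨B, hB, hBeq⟩ := hms
    refine integral_congr_ae ?_
    have h2 : ∀ᵐ z ∂(Q.map (X.Z 0)), z ∈ B := by
      refine (ae_map_iff hZ.aemeasurable (p := fun z => z ∈ B) hB).mpr ?_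
      filter_upwards [h1] with ω hω
      exact (Set.ext_iff.mp hBeq ω).mpr hω
    have h3 : ∀ᵐ ω ∂P, X.Z 0 ω ∈ B :=
      ae_of_ae_map hZ.aemeasurable ((Measure.absolutelyContinuous_of_le_smul hdom).ae_le h2)
    filter_upwards [h3] with ω hω
    exact (Set.ext_iff.mp hBeq ω).mp hω

end Identification

/-! ### Bias and variance of the estimated influence function -/

lemma eif_obs {Ω 𝒴 𝒵 : Type*} {X : Sample Ω 𝒴 𝒵} {t : Fin 2} {p : ℕ} {η : Nuisance p 𝒴 𝒵}
    (q Ψ : ℝ) (i : ℕ) (ω : Ω) :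
    eif t q η Ψ (X.obs i ω) =
      (if X.S i ω = 1 then 1 else 0) / q * (η.score (X.Y i ω) (X.Z i ω) / η.π (X.Z i ω)) *
          (X.Lt i ω - η.outcome (X.Y i ω) (X.Z i ω))
        + (if X.T i ω = t then 1 else 0) / η.π (X.Z i ω) *
          (η.outcome (X.Y i ω) (X.Z i ω) - η.mbar (X.Z i ω))
        + η.mbar (X.Z i ω) - Ψ := rfl

section Moments

variable {Ω 𝒴 𝒵 : Type*} [MeasurableSpace Ω] [MeasurableSpace 𝒴] [MeasurableSpace 𝒵]
  {P : Measure Ω} {X : Sample Ω 𝒴 𝒵} {t : Fin 2} {c : ℝ} {p : ℕ} {η ηh : Nuisance p 𝒴 𝒵}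

/-- The mean of the influence function at arbitrary admissible nuisance functions. The errors enter
only through products, and at the population nuisance functions the mean vanishes. -/
theorem IsIdentified.integral_eif [IsProbabilityMeasure P] (h : IsIdentified P X t c η)
    (ha : IsAdmissible P X c ηh) :
    Integrable (fun ω => eif t (P.real {ω | X.S 0 ω = 1}) ηh (target P X t) (X.obs 0 ω)) P ∧
    ∫ ω, eif t (P.real {ω | X.S 0 ω = 1}) ηh (target P X t) (X.obs 0 ω) ∂P =
      ∫ ω, -((ηh.π (X.Z 0 ω))⁻¹ *
        ((ηh.score (X.Y 0 ω) (X.Z 0 ω) - η.score (X.Y 0 ω) (X.Z 0 ω)) *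
            (ηh.outcome (X.Y 0 ω) (X.Z 0 ω) - η.outcome (X.Y 0 ω) (X.Z 0 ω)) -
          (ηh.π (X.Z 0 ω) - η.π (X.Z 0 ω)) *
            (ηh.mbar (X.Z 0 ω) - η.mbar (X.Z 0 ω)))) ∂P := by
  have hc := h.c_pos
  have hY := h.measurable_Y
  have hZ := h.measurable_Z
  have hYZ : Measurable fun ω => (X.Y 0 ω, X.Z 0 ω) := hY.prodMk hZ
  set q := P.real {ω | X.S 0 ω = 1} with hq
  have hq0 : 0 < q := h.annotated_pos
  set μ : Ω → ℝ := fun ω => η.outcome (X.Y 0 ω) (X.Z 0 ω) with hμ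
  set μh : Ω → ℝ := fun ω => ηh.outcome (X.Y 0 ω) (X.Z 0 ω) with hμh
  set m : Ω → ℝ := fun ω => η.mbar (X.Z 0 ω) with hm
  set mh : Ω → ℝ := fun ω => ηh.mbar (X.Z 0 ω) with hmh
  set ρ : Ω → ℝ := fun ω => η.score (X.Y 0 ω) (X.Z 0 ω)
  set ρh : Ω → ℝ := fun ω => ηh.score (X.Y 0 ω) (X.Z 0 ω) with hρh
  set w : Ω → ℝ := fun ω => (ηh.π (X.Z 0 ω))⁻¹ with hw
  set τ : Ω → ℝ := fun ω => if X.T 0 ω = t then 1 else 0 with hτ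
  set s : Ω → ℝ := fun ω => (if X.S 0 ω = 1 then 1 else 0) / q with hs
  have hρhm : Measurable ρh := ha.measurable_score.comp hYZ
  have hwm : Measurable w := ha.measurable_propensity.inv.comp hZ
  have hτm : Measurable τ :=
    Measurable.ite (h.measurable_T (measurableSet_singleton t)) measurable_const measurable_const
  have hsm : Measurable s :=
    (Measurable.ite (h.measurable_S (measurableSet_singleton 1)) measurable_const
      measurable_const).div_const q
  have hwb : ∀ᵐ ω ∂P, ‖w ω‖ ≤ c⁻¹ := by
    filter_upwards [ha.propensity_mem] with ω hω
    rw [Real.norm_eq_abs, abs_of_nonneg (inv_nonneg.mpr (hc.le.trans hω.1))]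
    exact inv_anti₀ hc hω.1
  have hτb : ∀ᵐ ω ∂P, ‖τ ω‖ ≤ 1 := .of_forall fun ω => by simp only [hτ]; split_ifs <;> simp
  have hsb : ∀ᵐ ω ∂P, ‖s ω‖ ≤ q⁻¹ := .of_forall fun ω => by
    simp only [hs]; split_ifs <;> simp [abs_of_pos hq0, hq0.le]
  have hρhb : ∀ᵐ ω ∂P, ‖ρh ω‖ ≤ 1 := by
    filter_upwards [ha.score_mem] with ω hω
    rw [Real.norm_eq_abs, abs_of_nonneg hω.1]; exact hω.2
  have hμi : Integrable μ P := h.admissible.memLp_outcome.integrable one_le_two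
  have hμhi : Integrable μh P := ha.memLp_outcome.integrable one_le_two
  have hmi : Integrable m P := h.admissible.memLp_mbar.integrable one_le_two
  have hmhi : Integrable mh P := ha.memLp_mbar.integrable one_le_two
  have hτi : Integrable τ P := .of_bound hτm.aestronglyMeasurable 1 hτb
  have wmul : ∀ {F : Ω → ℝ}, Integrable F P → Integrable (fun ω => w ω * F ω) P := fun hF =>
    hF.bdd_mul hwm.aestronglyMeasurable hwb
  have τmul : ∀ {F : Ω → ℝ}, Integrable F P → Integrable (fun ω => τ ω * F ω) P := fun hF =>
    hF.bdd_mul hτm.aestronglyMeasurable hτb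
  have ib := wmul (hμhi.sub hμi)
  have id := wmul (hmhi.sub hmi)
  have iG := wmul (hμi.sub hmi)
  -- the annotation term: `S` is independent of `(Y, Z)` and `E[1{S = 1}] / q = 1`
  have iA : Integrable (fun ω => ρh ω * (w ω * (μh ω - μ ω))) P :=
    ib.bdd_mul hρhm.aestronglyMeasurable hρhb
  have isA : Integrable (fun ω => s ω * (ρh ω * (w ω * (μh ω - μ ω)))) P :=
    iA.bdd_mul hsm.aestronglyMeasurable hsb
  have es : ∫ ω, s ω ∂P = 1 := by
    have : s = fun ω => ({ω | X.S 0 ω = 1}.indicator (fun _ => (1 : ℝ)) ω) / q := by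
      ext ω; by_cases hω : X.S 0 ω = 1 <;> simp [hs, hω]
    rw [this, integral_div, integral_indicator_const _
      (show MeasurableSet {ω | X.S 0 ω = 1} from h.measurable_S (measurableSet_singleton 1)),
      smul_eq_mul, mul_one, ← hq, div_self hq0.ne']
  have eA : ∫ ω, s ω * (ρh ω * (w ω * (μh ω - μ ω))) ∂P =
      ∫ ω, ρh ω * (w ω * (μh ω - μ ω)) ∂P := by
    have hφ : Measurable fun x : 𝒴 × 𝒵 => ηh.score x.1 x.2 *
        ((ηh.π x.2)⁻¹ * (ηh.outcome x.1 x.2 - η.outcome x.1 x.2)) :=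
      ha.measurable_score.mul ((ha.measurable_propensity.inv.comp measurable_snd).mul
        (ha.measurable_outcome.sub h.admissible.measurable_outcome))
    have hψ : Measurable fun a : Fin 2 => (if a = 1 then (1 : ℝ) else 0) / q := .of_discrete
    have := (h.indep.comp hψ hφ).integral_fun_mul_eq_mul_integral
      hsm.aestronglyMeasurable iA.aestronglyMeasurable
    refine this.trans ?_
    rw [show ∫ ω, ((fun a : Fin 2 => (if a = 1 then (1 : ℝ) else 0) / q) ∘ X.S 0) ω ∂P = 1 from es,
      one_mul]
    rfl
  -- the arm indicator is replaced by the surrogacy score in front of a function of `(Y, Z)`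
  have eb : ∫ ω, τ ω * (w ω * (μh ω - μ ω)) ∂P = ∫ ω, ρ ω * (w ω * (μh ω - μ ω)) ∂P := by
    have hφ : Measurable fun x : 𝒴 × 𝒵 => (ηh.π x.2)⁻¹ *
        (ηh.outcome x.1 x.2 - η.outcome x.1 x.2) :=
      (ha.measurable_propensity.inv.comp measurable_snd).mul
        (ha.measurable_outcome.sub h.admissible.measurable_outcome)
    have := h.score.integral_mul hYZ hτi hφ ((τmul ib).congr (.of_forall fun ω => mul_comm _ _))
    simp_rw [mul_comm (τ _), mul_comm (ρ _)]
    exact this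
  -- and by the propensity score in front of a function of `Z`
  have ed : ∫ ω, τ ω * (w ω * (mh ω - m ω)) ∂P =
      ∫ ω, η.π (X.Z 0 ω) * (w ω * (mh ω - m ω)) ∂P := by
    have hφ : Measurable fun z : 𝒵 => (ηh.π z)⁻¹ * (ηh.mbar z - η.mbar z) :=
      ha.measurable_propensity.inv.mul (ha.measurable_mbar.sub h.admissible.measurable_mbar)
    have := h.propensity.integral_mul hZ hτi hφ
      ((τmul id).congr (.of_forall fun ω => mul_comm _ _))
    simp_rw [mul_comm (τ _), mul_comm (η.π _)]
    exact this
  have eG : ∫ ω, τ ω * (w ω * (μ ω - m ω)) ∂P = 0 :=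
    h.mbar (fun z => (ηh.π z)⁻¹) ha.measurable_propensity.inv ⟨c⁻¹, hwb⟩
  have iρ : Integrable (fun ω => ρ ω * (w ω * (μh ω - μ ω))) P := by
    refine ib.bdd_mul (c := 1) (h.admissible.measurable_score.comp hYZ).aestronglyMeasurable ?_
    filter_upwards [h.admissible.score_mem] with ω hω
    rw [Real.norm_eq_abs, abs_of_nonneg hω.1]; exact hω.2
  have iπ : Integrable (fun ω => η.π (X.Z 0 ω) * (w ω * (mh ω - m ω))) P := by
    refine id.bdd_mul (c := 1) (h.admissible.measurable_propensity.comp hZ).aestronglyMeasurable ?_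
    filter_upwards [h.admissible.propensity_mem] with ω hω
    rw [Real.norm_eq_abs, abs_of_nonneg (hc.le.trans hω.1)]; exact hω.2
  have decomp : (fun ω => eif t q ηh (target P X t) (X.obs 0 ω)) =ᵐ[P] fun ω =>
      τ ω * (w ω * (μh ω - μ ω)) - s ω * (ρh ω * (w ω * (μh ω - μ ω)))
        - τ ω * (w ω * (mh ω - m ω)) + τ ω * (w ω * (μ ω - m ω))
        + (mh ω - m ω) + (m ω - target P X t) := by
    filter_upwards [h.label] with ω hω
    rw [eif_obs, hω]
    simp only [hμ, hμh, hm, hmh, hρh, hw, hτ, hs]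
    ring
  have i1 := (τmul ib).sub isA
  have i2 := i1.sub (τmul id)
  have i3 := i2.add (τmul iG)
  have i4 := i3.add (hmhi.sub hmi)
  have i5 := hmi.sub (integrable_const (target P X t))
  refine ⟨(i4.add i5).congr decomp.symm, ?_⟩
  rw [integral_congr_ae decomp]
  calc _ = ∫ ω, ρ ω * (w ω * (μh ω - μ ω)) ∂P - ∫ ω, ρh ω * (w ω * (μh ω - μ ω)) ∂P
        - ∫ ω, η.π (X.Z 0 ω) * (w ω * (mh ω - m ω)) ∂P + ∫ ω, (mh ω - m ω) ∂P := by
        have e5 : ∫ ω, (m ω - target P X t) ∂P = 0 := by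
          rw [integral_sub hmi (integrable_const _), ← h.target_eq]; simp
        have s5 := integral_add i4 i5
        have s4 := integral_add i3 (hmhi.sub hmi)
        have s3 := integral_add i2 (τmul iG)
        have s2 := integral_sub i1 (τmul id)
        have s1 := integral_sub (τmul ib) isA
        simp only [Pi.add_apply, Pi.sub_apply] at s1 s2 s3 s4 s5
        rw [s5, s4, s3, s2, s1, eA, eb, ed, eG, e5]
        ring
    _ = ∫ ω, (ρ ω * (w ω * (μh ω - μ ω)) - ρh ω * (w ω * (μh ω - μ ω))
        - η.π (X.Z 0 ω) * (w ω * (mh ω - m ω)) + (mh ω - m ω)) ∂P := by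
        have s3 := integral_add ((iρ.sub iA).sub iπ) (hmhi.sub hmi)
        have s2 := integral_sub (iρ.sub iA) iπ
        have s1 := integral_sub iρ iA
        simp only [Pi.sub_apply] at s1 s2 s3
        rw [s3, s2, s1]
    _ = _ := by
        refine integral_congr_ae ?_
        filter_upwards [ha.propensity_mem] with ω hω
        have hne : ηh.π (X.Z 0 ω) ≠ 0 := (hc.trans_le hω.1).ne'
        simp only [hw]
        field_simp
        ring

/-- The influence function is centred. -/
theorem IsIdentified.integral_eif_eq_zero [IsProbabilityMeasure P] (h : IsIdentified P X t c η) :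
    ∫ ω, eif t (P.real {ω | X.S 0 ω = 1}) η (target P X t) (X.obs 0 ω) ∂P = 0 := by
  rw [(h.integral_eif h.admissible).2]
  simp

/-- The bias of an estimated influence function is at most of the order of the products of the
errors. -/
theorem IsIdentified.enorm_integral_eif_le [IsProbabilityMeasure P] (h : IsIdentified P X t c η)
    (ha : IsAdmissible P X c ηh) :
    ‖∫ ω, eif t (P.real {ω | X.S 0 ω = 1}) ηh (target P X t) (X.obs 0 ω) ∂P‖ₑ ≤
      ENNReal.ofReal c⁻¹ * (l2dist P X ηh.score η.score * l2dist P X ηh.outcome η.outcome +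
        l2dist P X (fun _ => ηh.π) (fun _ => η.π) *
          l2dist P X (fun _ => ηh.mbar) (fun _ => η.mbar)) := by
  have hc := h.c_pos
  have hZ := h.measurable_Z
  have hYZ : Measurable fun ω => (X.Y 0 ω, X.Z 0 ω) := h.measurable_Y.prodMk hZ
  rw [(h.integral_eif ha).2]
  refine (enorm_integral_le_lintegral_enorm _).trans ?_
  rw [← eLpNorm_one_eq_lintegral_enorm]
  set a : Ω → ℝ := fun ω => ηh.score (X.Y 0 ω) (X.Z 0 ω) - η.score (X.Y 0 ω) (X.Z 0 ω)
  set b : Ω → ℝ := fun ω => ηh.outcome (X.Y 0 ω) (X.Z 0 ω) - η.outcome (X.Y 0 ω) (X.Z 0 ω)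
  set e : Ω → ℝ := fun ω => ηh.π (X.Z 0 ω) - η.π (X.Z 0 ω)
  set d : Ω → ℝ := fun ω => ηh.mbar (X.Z 0 ω) - η.mbar (X.Z 0 ω)
  have hbd : ∀ᵐ ω ∂P, ‖-((ηh.π (X.Z 0 ω))⁻¹ * (a ω * b ω - e ω * d ω))‖ ≤
      c⁻¹ * ‖(a • b - e • d) ω‖ := by
    filter_upwards [ha.propensity_mem] with ω hω
    rw [norm_neg, norm_mul, Real.norm_eq_abs (_⁻¹),
      abs_of_nonneg (inv_nonneg.mpr (hc.le.trans hω.1))]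
    exact mul_le_mul_of_nonneg_right (inv_anti₀ hc hω.1) (norm_nonneg _)
  have ham : AEStronglyMeasurable a P :=
    ((ha.measurable_score.sub h.admissible.measurable_score).comp hYZ).aestronglyMeasurable
  have hbm : AEStronglyMeasurable b P :=
    ((ha.measurable_outcome.sub h.admissible.measurable_outcome).comp hYZ).aestronglyMeasurable
  have hem : AEStronglyMeasurable e P :=
    ((ha.measurable_propensity.sub h.admissible.measurable_propensity).comp hZ).aestronglyMeasurable
  have hdm : AEStronglyMeasurable d P :=
    ((ha.measurable_mbar.sub h.admissible.measurable_mbar).comp hZ).aestronglyMeasurable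
  refine (eLpNorm_le_mul_eLpNorm_of_ae_le_mul hbd 1).trans ?_
  gcongr
  refine (eLpNorm_sub_le (ham.smul hbm) (hem.smul hdm) le_rfl).trans ?_
  exact add_le_add (eLpNorm_smul_le_mul_eLpNorm hbm ham) (eLpNorm_smul_le_mul_eLpNorm hdm hem)

/-- The `L²` distance between the estimated and the true influence function. The error of the
propensity score is multiplied by the unbounded residual `μ - m̄_t`, which is therefore truncated at
an arbitrary level `M`. -/
theorem IsIdentified.eLpNorm_eif_sub_le [IsProbabilityMeasure P] (h : IsIdentified P X t c η)
    (ha : IsAdmissible P X c ηh) (Ψ : ℝ) {M : ℝ} (hM : 0 ≤ M) :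
    eLpNorm (fun ω => eif t (P.real {ω | X.S 0 ω = 1}) ηh Ψ (X.obs 0 ω) -
        eif t (P.real {ω | X.S 0 ω = 1}) η Ψ (X.obs 0 ω)) 2 P ≤
      ENNReal.ofReal ((P.real {ω | X.S 0 ω = 1} * c)⁻¹ + c⁻¹ + 1 + c⁻¹ ^ 2) *
        (l2dist P X ηh.outcome η.outcome + l2dist P X (fun _ => ηh.mbar) (fun _ => η.mbar) +
          ENNReal.ofReal M * l2dist P X (fun _ => ηh.π) (fun _ => η.π) +
          eLpNorm ({ω | M ≤ ‖η.outcome (X.Y 0 ω) (X.Z 0 ω) - η.mbar (X.Z 0 ω)‖₊}.indicator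
            fun ω => η.outcome (X.Y 0 ω) (X.Z 0 ω) - η.mbar (X.Z 0 ω)) 2 P) := by
  have hc := h.c_pos
  have hZ := h.measurable_Z
  have hYZ : Measurable fun ω => (X.Y 0 ω, X.Z 0 ω) := h.measurable_Y.prodMk hZ
  set q := P.real {ω | X.S 0 ω = 1}
  have hq0 : 0 < q := h.annotated_pos
  set b : Ω → ℝ := fun ω => ηh.outcome (X.Y 0 ω) (X.Z 0 ω) - η.outcome (X.Y 0 ω) (X.Z 0 ω) with hb
  set e : Ω → ℝ := fun ω => ηh.π (X.Z 0 ω) - η.π (X.Z 0 ω) with he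
  set d : Ω → ℝ := fun ω => ηh.mbar (X.Z 0 ω) - η.mbar (X.Z 0 ω) with hd
  set G : Ω → ℝ := fun ω => η.outcome (X.Y 0 ω) (X.Z 0 ω) - η.mbar (X.Z 0 ω) with hG
  set κ : ℝ := (q * c)⁻¹ + c⁻¹ + 1 + c⁻¹ ^ 2 with hκ
  have hGm : Measurable G :=
    (h.admissible.measurable_outcome.comp hYZ).sub (h.admissible.measurable_mbar.comp hZ)
  have hbm : AEStronglyMeasurable b P :=
    ((ha.measurable_outcome.sub h.admissible.measurable_outcome).comp hYZ).aestronglyMeasurable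
  have hem : AEStronglyMeasurable e P :=
    ((ha.measurable_propensity.sub h.admissible.measurable_propensity).comp hZ).aestronglyMeasurable
  have hdm : AEStronglyMeasurable d P :=
    ((ha.measurable_mbar.sub h.admissible.measurable_mbar).comp hZ).aestronglyMeasurable
  have hMs : MeasurableSet {ω | M ≤ ‖G ω‖₊} :=
    measurableSet_le measurable_const hGm.norm
  set H : Ω → ℝ := {ω | M ≤ ‖G ω‖₊}.indicator G
  have hHm : AEStronglyMeasurable H P := (hGm.indicator hMs).aestronglyMeasurable
  have hbd : ∀ᵐ ω ∂P, ‖eif t q ηh Ψ (X.obs 0 ω) - eif t q η Ψ (X.obs 0 ω)‖ ≤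
      κ * ‖((fun ω => ‖b ω‖) + (fun ω => ‖d ω‖) + (fun ω => M * ‖e ω‖) + fun ω => ‖H ω‖) ω‖ := by
    filter_upwards [h.label, ha.score_mem, ha.propensity_mem, h.admissible.propensity_mem]
      with ω h1 h2 h3 h4
    have hw : 0 < ηh.π (X.Z 0 ω) := hc.trans_le h3.1
    have hv : 0 < η.π (X.Z 0 ω) := hc.trans_le h4.1
    have hwc : (ηh.π (X.Z 0 ω))⁻¹ ≤ c⁻¹ := inv_anti₀ hc h3.1
    have hvc : (η.π (X.Z 0 ω))⁻¹ ≤ c⁻¹ := inv_anti₀ hc h4.1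
    have he1 : |e ω| ≤ 1 := by
      rw [abs_le]; simp only [he]; constructor <;> linarith [h3.1, h3.2, h4.1, h4.2]
    have hGe : |G ω| * |e ω| ≤ M * |e ω| + |H ω| := by
      by_cases hω : M ≤ |G ω|
      · have : H ω = G ω := Set.indicator_of_mem (show ω ∈ {ω | M ≤ ‖G ω‖₊} from hω) G
        rw [this]
        nlinarith [abs_nonneg (G ω), abs_nonneg (e ω)]
      · push Not at hω
        nlinarith [abs_nonneg (H ω), abs_nonneg (e ω)]
    set s : ℝ := if X.S 0 ω = 1 then 1 else 0 with hs
    set τ : ℝ := if X.T 0 ω = t then 1 else 0 with hτ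
    have hs1 : |s| ≤ 1 := by rw [hs]; split_ifs <;> simp
    have hτ1 : |τ| ≤ 1 := by rw [hτ]; split_ifs <;> simp
    have key : eif t q ηh Ψ (X.obs 0 ω) - eif t q η Ψ (X.obs 0 ω) =
        -(q⁻¹ * (ηh.π (X.Z 0 ω))⁻¹ * (s * ηh.score (X.Y 0 ω) (X.Z 0 ω))) * b ω
          + (ηh.π (X.Z 0 ω))⁻¹ * τ * (b ω - d ω) + d ω
          - (ηh.π (X.Z 0 ω))⁻¹ * (η.π (X.Z 0 ω))⁻¹ * τ * (G ω * e ω) := by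
      rw [eif_obs, eif_obs, h1]
      simp only [hb, hd, hG, he, ← hs, ← hτ]
      field_simp
      ring
    have n1 : |-(q⁻¹ * (ηh.π (X.Z 0 ω))⁻¹ * (s * ηh.score (X.Y 0 ω) (X.Z 0 ω))) * b ω| ≤
        (q * c)⁻¹ * |b ω| := by
      rw [abs_mul, abs_neg, abs_mul, abs_mul, abs_mul, abs_of_pos (inv_pos.mpr hq0),
        abs_of_pos (inv_pos.mpr hw), abs_of_nonneg h2.1, mul_inv]
      refine mul_le_mul_of_nonneg_right ?_ (abs_nonneg _)
      calc q⁻¹ * (ηh.π (X.Z 0 ω))⁻¹ * (|s| * ηh.score (X.Y 0 ω) (X.Z 0 ω))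
          ≤ q⁻¹ * c⁻¹ * (1 * 1) := by
            have := h2.1
            have := h2.2
            gcongr
        _ = q⁻¹ * c⁻¹ := by ring
    have n2 : |(ηh.π (X.Z 0 ω))⁻¹ * τ * (b ω - d ω)| ≤ c⁻¹ * (|b ω| + |d ω|) := by
      rw [abs_mul, abs_mul, abs_of_pos (inv_pos.mpr hw)]
      calc (ηh.π (X.Z 0 ω))⁻¹ * |τ| * |b ω - d ω| ≤ c⁻¹ * 1 * (|b ω| + |d ω|) := by
            have := abs_sub (b ω) (d ω)
            gcongr
        _ = _ := by ring
    have n3 : |(ηh.π (X.Z 0 ω))⁻¹ * (η.π (X.Z 0 ω))⁻¹ * τ * (G ω * e ω)| ≤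
        c⁻¹ ^ 2 * (M * |e ω| + |H ω|) := by
      rw [abs_mul, abs_mul, abs_mul, abs_of_pos (inv_pos.mpr hw), abs_of_pos (inv_pos.mpr hv),
        abs_mul]
      calc (ηh.π (X.Z 0 ω))⁻¹ * (η.π (X.Z 0 ω))⁻¹ * |τ| * (|G ω| * |e ω|)
          ≤ c⁻¹ * c⁻¹ * 1 * (M * |e ω| + |H ω|) := by
            gcongr
        _ = _ := by ring
    rw [key]
    simp only [Pi.add_apply, Real.norm_eq_abs]
    rw [abs_of_nonneg (a := |b ω| + |d ω| + M * |e ω| + |H ω|) (by positivity)]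
    refine (abs_sub _ _).trans ((add_le_add ((abs_add_le _ _).trans (add_le_add
      ((abs_add_le _ _).trans (add_le_add n1 n2)) le_rfl)) n3).trans ?_)
    have p1 : 0 ≤ (q * c)⁻¹ := by positivity
    have p2 : 0 ≤ c⁻¹ := by positivity
    have p3 : 0 ≤ c⁻¹ ^ 2 := by positivity
    have p4 : 0 ≤ M * |e ω| + |H ω| := by positivity
    have p5 : 0 ≤ (q * c)⁻¹ * |d ω| + (q * c)⁻¹ * (M * |e ω| + |H ω|) +
        c⁻¹ * (M * |e ω| + |H ω|) + |b ω| + (M * |e ω| + |H ω|) +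
        c⁻¹ ^ 2 * |b ω| + c⁻¹ ^ 2 * |d ω| := by positivity
    simp only [hκ]
    linarith
  refine (eLpNorm_le_mul_eLpNorm_of_ae_le_mul hbd 2).trans ?_
  gcongr
  have eM : eLpNorm (fun ω => M * ‖e ω‖) 2 P = ENNReal.ofReal M * eLpNorm e 2 P := by
    have : (fun ω => M * ‖e ω‖) = M • fun ω => ‖e ω‖ := rfl
    rw [this, eLpNorm_const_smul, eLpNorm_norm, Real.enorm_eq_ofReal hM]
  have mM : AEStronglyMeasurable (fun ω => M * ‖e ω‖) P := hem.norm.const_mul M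
  refine (eLpNorm_add_le ((hbm.norm.add hdm.norm).add mM) hHm.norm one_le_two).trans ?_
  rw [eLpNorm_norm]
  gcongr
  refine (eLpNorm_add_le (hbm.norm.add hdm.norm) mM one_le_two).trans ?_
  rw [eM]
  gcongr
  · refine (eLpNorm_add_le hbm.norm hdm.norm one_le_two).trans ?_
    rw [eLpNorm_norm, eLpNorm_norm]
    rfl
  · rfl

end Moments

/-! ### Sums over a held-out fold -/

section CrossFitting

variable {O 𝒰 : Type*} [MeasurableSpace O] [MeasurableSpace 𝒰]

lemma lintegral_enorm_sq_eq_ofReal {α : Type*} [MeasurableSpace α] {ν : Measure α} {F : α → ℝ}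
    (hF : MemLp F 2 ν) : ∫⁻ x, ‖F x‖ₑ ^ 2 ∂ν = ENNReal.ofReal (∫ x, F x ^ 2 ∂ν) := by
  rw [ofReal_integral_eq_lintegral_ofReal hF.integrable_sq (.of_forall fun x => sq_nonneg _)]
  refine lintegral_congr fun x => ?_
  rw [← Real.enorm_of_nonneg (sq_nonneg _), enorm_pow]

/-- The second moment of a sum of independent identically distributed variables: a variance part of
order `m` and a bias part of order `m²`. -/
lemma lintegral_pi_enorm_sum_sq_le {ι : Type*} [Fintype ι] {Q : Measure O} [IsProbabilityMeasure Q]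
    {h : O → ℝ} (hh : MemLp h 2 Q) :
    ∫⁻ y, ‖∑ i, h (y i)‖ₑ ^ 2 ∂(Measure.pi fun _ : ι => Q) ≤
      Fintype.card ι * ∫⁻ o, ‖h o‖ₑ ^ 2 ∂Q + (Fintype.card ι * ‖∫ o, h o ∂Q‖ₑ) ^ 2 := by
  have hi : ∀ i : ι, MemLp (fun y : ι → O => h (y i)) 2 (Measure.pi fun _ => Q) := fun i =>
    hh.comp_measurePreserving (measurePreserving_eval (fun _ => Q) i)
  have hsum : MemLp (fun y : ι → O => ∑ i, h (y i)) 2 (Measure.pi fun _ => Q) :=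
    memLp_finsetSum _ fun i _ => hi i
  have hmean : ∫ y : ι → O, ∑ i, h (y i) ∂(Measure.pi fun _ => Q) =
      Fintype.card ι * ∫ o, h o ∂Q := by
    rw [integral_finsetSum _ fun i _ => (hi i).integrable one_le_two]
    have : ∀ i : ι, ∫ y : ι → O, h (y i) ∂(Measure.pi fun _ => Q) = ∫ o, h o ∂Q := fun i =>
      integral_comp_eval (μ := fun _ : ι => Q) (i := i) hh.aestronglyMeasurable
    simp [this]
  have hvar := variance_sum_pi (μ := fun _ : ι => Q) (X := fun _ => h) fun _ => hh
  have hfun : (∑ i : ι, fun y : ι → O => h (y i)) = fun y => ∑ i, h (y i) := by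
    ext y; simp
  rw [hfun, variance_eq_sub hsum, hmean] at hvar
  have hvle : Var[h; Q] ≤ ∫ o, h o ^ 2 ∂Q := variance_le_expectation_sq hh.aestronglyMeasurable
  rw [lintegral_enorm_sq_eq_ofReal hsum, lintegral_enorm_sq_eq_ofReal hh]
  have e : (Fintype.card ι * ENNReal.ofReal (∫ o, h o ^ 2 ∂Q) +
      (Fintype.card ι * ‖∫ o, h o ∂Q‖ₑ) ^ 2 : ENNReal) =
      ENNReal.ofReal (Fintype.card ι * ∫ o, h o ^ 2 ∂Q +
        (Fintype.card ι * ∫ o, h o ∂Q) ^ 2) := by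
    have h2 : 0 ≤ ∫ o, h o ^ 2 ∂Q := integral_nonneg fun o => sq_nonneg _
    rw [ENNReal.ofReal_add (by positivity) (sq_nonneg _), ENNReal.ofReal_mul (by positivity),
      ENNReal.ofReal_natCast, ← Real.enorm_of_nonneg (sq_nonneg (_ * _)), enorm_pow, enorm_mul,
      Real.enorm_natCast]
  rw [e]
  refine ENNReal.ofReal_le_ofReal ?_
  simp only [Finset.sum_const, Finset.card_univ, nsmul_eq_mul, Pi.pow_apply] at hvar
  have : (Fintype.card ι : ℝ) * Var[h; Q] ≤ Fintype.card ι * ∫ o, h o ^ 2 ∂Q := by gcongr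
  linarith

/-- The function `h` of an observation has second moment at most `v²` and mean in absolute value at
most `v / √n`. -/
def SmallMoments (Q : Measure O) (n : ℕ) (v : ENNReal) (h : O → ℝ) : Prop :=
  ∫⁻ o, ‖h o‖ₑ ^ 2 ∂Q ≤ v ^ 2 ∧ ENNReal.ofReal √n * ‖∫ o, h o ∂Q‖ₑ ≤ v

lemma measurableSet_smallMoments {α : Type*} [MeasurableSpace α] {Q : Measure O} [SFinite Q]
    {n : ℕ} {v : ENNReal} {g : α → O → ℝ} (hg : Measurable (Function.uncurry g)) :
    MeasurableSet {x | SmallMoments Q n v (g x)} := by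
  have h1 : Measurable fun x => ∫⁻ o, ‖g x o‖ₑ ^ 2 ∂Q :=
    (hg.enorm.pow_const 2).lintegral_prod_right'
  have h2 : Measurable fun x => ∫ o, g x o ∂Q :=
    (hg.stronglyMeasurable.integral_prod_right' (ν := Q)).measurable
  exact (measurableSet_le h1 measurable_const).inter
    (measurableSet_le (h2.enorm.const_mul _) measurable_const)

open Classical in
/-- Sample splitting: if the fitted function `g d` does not depend on the observations in `J`, then
conditionally on the other observations the sum over `J` is a sum of i.i.d. variables. -/
lemma lintegral_indicator_sum_sq_le {n : ℕ} {Q : Measure O} [IsProbabilityMeasure Q]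
    (J : Finset (Fin n)) {g : (Fin n → O) → O → ℝ} (hg : Measurable (Function.uncurry g))
    (hout : ∀ d d', (∀ i ∉ J, d i = d' i) → g d = g d') (v : ENNReal) (hv : v ≠ ⊤) :
    ∫⁻ d, {d | SmallMoments Q n v (g d)}.indicator (fun d => ‖∑ i ∈ J, g d (d i)‖ₑ ^ 2) d
        ∂(Measure.pi fun _ => Q) ≤ 2 * n * v ^ 2 := by
  have hA := measurableSet_smallMoments (Q := Q) (n := n) (v := v) hg
  have hterm : ∀ i, Measurable fun d : Fin n → O => g d (d i) := fun i =>
    hg.comp (measurable_id.prodMk (measurable_pi_apply i))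
  have hF : Measurable ({d | SmallMoments Q n v (g d)}.indicator
      fun d : Fin n → O => ‖∑ i ∈ J, g d (d i)‖ₑ ^ 2) :=
    ((Finset.measurable_sum J fun i _ => hterm i).enorm.pow_const 2).indicator hA
  refine (lintegral_le_of_lmarginal_le J hF (g := fun _ => 2 * n * v ^ 2) measurable_const
    fun x => ?_).trans (by simp)
  simp only [lmarginal, lintegral_const, measure_univ, mul_one]
  have hupd : ∀ y : (i : J) → O, g (Function.updateFinset x J y) = g x := fun y =>
    hout _ _ fun i hi => by simp [Function.updateFinset, hi]
  by_cases hx : SmallMoments Q n v (g x)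
  swap
  · have : ∀ y : (i : J) → O, {d | SmallMoments Q n v (g d)}.indicator
        (fun d => ‖∑ i ∈ J, g d (d i)‖ₑ ^ 2) (Function.updateFinset x J y) = 0 := fun y =>
      Set.indicator_of_notMem (by simpa [hupd y] using hx) _
    simp [this]
  have e : ∀ y : (i : J) → O, {d | SmallMoments Q n v (g d)}.indicator
      (fun d => ‖∑ i ∈ J, g d (d i)‖ₑ ^ 2) (Function.updateFinset x J y) =
      ‖∑ i : J, g x (y i)‖ₑ ^ 2 := fun y => by
    rw [Set.indicator_of_mem (by simpa [hupd y] using hx), hupd y, ← Finset.sum_coe_sort J]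
    congr 3
    ext i
    simp [Function.updateFinset]
  simp_rw [e]
  have hgx : Measurable (g x) := hg.comp measurable_prodMk_left
  have hmem : MemLp (g x) 2 Q := by
    refine ⟨hgx.aestronglyMeasurable, ?_⟩
    rw [eLpNorm_lt_top_iff_lintegral_rpow_enorm_lt_top two_ne_zero ENNReal.ofNat_ne_top]
    simpa using hx.1.trans_lt (ENNReal.pow_lt_top hv.lt_top)
  refine (lintegral_pi_enorm_sum_sq_le hmem).trans ?_
  have hJ : Fintype.card J ≤ n := by
    simpa using J.card_le_univ
  have hJ' : (Fintype.card J : ENNReal) ≤ n := by exact_mod_cast hJ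
  have hsq : (ENNReal.ofReal √n) ^ 2 = n := by
    rw [← ENNReal.ofReal_pow (Real.sqrt_nonneg _), Real.sq_sqrt n.cast_nonneg,
      ENNReal.ofReal_natCast]
  calc (Fintype.card J : ENNReal) * ∫⁻ o, ‖g x o‖ₑ ^ 2 ∂Q +
        (Fintype.card J * ‖∫ o, g x o ∂Q‖ₑ) ^ 2
      ≤ n * v ^ 2 + (n * ‖∫ o, g x o ∂Q‖ₑ) ^ 2 := by
        gcongr
        exact hx.1
    _ = n * v ^ 2 + n * (ENNReal.ofReal √n * ‖∫ o, g x o ∂Q‖ₑ) ^ 2 := by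
        rw [mul_pow, mul_pow, hsq]; ring
    _ ≤ n * v ^ 2 + n * v ^ 2 := by
        gcongr
        exact hx.2
    _ = 2 * n * v ^ 2 := by ring

/-- Chebyshev's inequality for the sum over a random fold `J u`, in probability over the sample and
over the auxiliary randomness `u`. -/
lemma prod_measure_sum_fold_le {n : ℕ} {Q : Measure O} [IsProbabilityMeasure Q]
    {ν : Measure 𝒰} [IsProbabilityMeasure ν] (J : 𝒰 → Finset (Fin n))
    (hJ : ∀ i, MeasurableSet {u | i ∈ J u}) {g : 𝒰 → (Fin n → O) → O → ℝ}
    (hg : Measurable fun x : (𝒰 × (Fin n → O)) × O => g x.1.1 x.1.2 x.2)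
    (hout : ∀ u d d', (∀ i ∉ J u, d i = d' i) → g u d = g u d') {v : ENNReal} (hv : v ≠ ⊤)
    {r : ENNReal} (hr0 : r ≠ 0) (hr : r ≠ ⊤) :
    (ν.prod (Measure.pi fun _ => Q)) {x | SmallMoments Q n v (g x.1 x.2) ∧
      r ≤ ‖∑ i ∈ J x.1, g x.1 x.2 (x.2 i)‖ₑ} ≤ 2 * n * v ^ 2 / r ^ 2 := by
  have hA : MeasurableSet {x : 𝒰 × (Fin n → O) | SmallMoments Q n v (g x.1 x.2)} :=
    measurableSet_smallMoments (g := fun x : 𝒰 × (Fin n → O) => g x.1 x.2) hg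
  have hsum : Measurable fun x : 𝒰 × (Fin n → O) => ∑ i ∈ J x.1, g x.1 x.2 (x.2 i) := by
    have : (fun x : 𝒰 × (Fin n → O) => ∑ i ∈ J x.1, g x.1 x.2 (x.2 i)) =
        fun x => ∑ i, {x : 𝒰 × (Fin n → O) | i ∈ J x.1}.indicator
          (fun x => g x.1 x.2 (x.2 i)) x := by
      ext x
      simp [Set.indicator_apply, Finset.sum_ite_mem]
    rw [this]
    refine Finset.measurable_sum _ fun i _ => Measurable.indicator ?_ (measurable_fst (hJ i))
    exact hg.comp (measurable_id.prodMk ((measurable_pi_apply i).comp measurable_snd))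
  have hset := hA.inter (measurableSet_le (measurable_const (a := r)) hsum.enorm)
  rw [show {x : 𝒰 × (Fin n → O) | SmallMoments Q n v (g x.1 x.2) ∧
      r ≤ ‖∑ i ∈ J x.1, g x.1 x.2 (x.2 i)‖ₑ} = _ from rfl]
  refine (Measure.prod_apply hset).trans_le ?_
  refine (lintegral_mono (g := fun _ => 2 * n * v ^ 2 / r ^ 2) fun u => ?_).trans (by simp)
  have hgu : Measurable (Function.uncurry (g u)) :=
    hg.comp ((measurable_prodMk_left.comp measurable_fst).prodMk measurable_snd)
  have hmk : Measurable fun d : Fin n → O => (u, d) := measurable_prodMk_left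
  have hind : Measurable ({d | SmallMoments Q n v (g u d)}.indicator
      fun d : Fin n → O => ‖∑ i ∈ J u, g u d (d i)‖ₑ ^ 2) :=
    ((hsum.comp hmk).enorm.pow_const 2).indicator (hmk hA)
  refine (measure_mono ?_).trans ((meas_ge_le_lintegral_div hind.aemeasurable
    (pow_ne_zero 2 hr0) (ENNReal.pow_ne_top hr)).trans
    (ENNReal.div_le_div_right (lintegral_indicator_sum_sq_le (J u) hgu (hout u) v hv) _))
  rintro d ⟨h1, h2⟩
  have h1' : d ∈ {d | SmallMoments Q n v (g u d)} := h1
  simp only [Set.mem_ofPred_eq]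
  rw [Set.indicator_of_mem h1']
  exact pow_le_pow_left' h2 2

end CrossFitting

/-! ### Negligibility of the nuisance estimation -/

lemma eif_sub {𝒴 𝒵 : Type*} {p : ℕ} (t : Fin 2) (q : ℝ) (η : Nuisance p 𝒴 𝒵) (Ψ Ψ' : ℝ)
    (o : Obs 𝒴 𝒵) :
    eif t q η Ψ' o = eif t q η Ψ o - (Ψ' - Ψ) := by
  obtain ⟨T, Lt, S, y, z⟩ := o
  simp only [eif]
  ring

section Estimation

variable {Ω 𝒴 𝒵 𝒰 : Type*} [MeasurableSpace Ω] [MeasurableSpace 𝒴] [MeasurableSpace 𝒵]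
  [MeasurableSpace 𝒰] {p : ℕ}

lemma measurable_eif {α : Type*} [MeasurableSpace α] (t : Fin 2) (q Ψ : ℝ)
    {η : α → Nuisance p 𝒴 𝒵}
    (hρ : Measurable fun x : α × 𝒴 × 𝒵 => (η x.1).score x.2.1 x.2.2)
    (hμ : Measurable fun x : α × 𝒴 × 𝒵 => (η x.1).outcome x.2.1 x.2.2)
    (hπ : Measurable fun x : α × 𝒵 => (η x.1).π x.2)
    (hm : Measurable fun x : α × 𝒵 => (η x.1).mbar x.2) :
    Measurable fun x : α × Obs 𝒴 𝒵 => eif t q (η x.1) Ψ x.2 := by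
  have hT : Measurable fun x : α × Obs 𝒴 𝒵 => x.2.1 := measurable_fst.comp measurable_snd
  have hLt : Measurable fun x : α × Obs 𝒴 𝒵 => x.2.2.1 := by fun_prop
  have hS : Measurable fun x : α × Obs 𝒴 𝒵 => x.2.2.2.1 := by fun_prop
  have hYZ : Measurable fun x : α × Obs 𝒴 𝒵 => (x.1, x.2.2.2.2) := by fun_prop
  have hZ : Measurable fun x : α × Obs 𝒴 𝒵 => (x.1, x.2.2.2.2.2) := by fun_prop
  have iT : Measurable fun x : α × Obs 𝒴 𝒵 => if x.2.1 = t then (1 : ℝ) else 0 :=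
    Measurable.ite (hT (measurableSet_singleton t)) measurable_const measurable_const
  have iS : Measurable fun x : α × Obs 𝒴 𝒵 => if x.2.2.2.1 = 1 then (1 : ℝ) else 0 :=
    Measurable.ite (hS (measurableSet_singleton 1)) measurable_const measurable_const
  have h1 := hρ.comp hYZ
  have h2 := hμ.comp hYZ
  have h3 := hπ.comp hZ
  have h4 := hm.comp hZ
  exact (((((iS.div_const q).mul (h1.div h3)).mul (hLt.sub h2)).add
    ((iT.div h3).mul (h2.sub h4))).add h4).sub_const Ψ

lemma CrossFit.sum_sum_fold {K : ℕ} (C : CrossFit K p 𝒰 𝒴 𝒵) (m : ℕ) (u : 𝒰)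
    (F : Fin (K * m) → ℝ) :
    ∑ k : Fin K, ∑ i ∈ Finset.univ.filter (fun i => C.fold m u i = k), F i = ∑ i, F i :=
  Finset.sum_fiberwise _ _ _

/-- The estimating function is affine in the parameter with slope `-1`. -/
lemma CrossFit.estimatingFn_sub {K : ℕ} (C : CrossFit K p 𝒰 𝒴 𝒵) (t : Fin 2) (q : ℝ) {m : ℕ}
    (hn : K * m ≠ 0) (u : 𝒰) (d : Fin (K * m) → Obs 𝒴 𝒵) (Ψ Ψ' : ℝ) :
    C.estimatingFn t q m u d Ψ' = C.estimatingFn t q m u d Ψ - (Ψ' - Ψ) := by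
  have hn' : ((K * m : ℕ) : ℝ) ≠ 0 := Nat.cast_ne_zero.mpr hn
  simp only [CrossFit.estimatingFn]
  have e : ∀ k i, eif t q (C.fit m k u d) Ψ' (d i) = eif t q (C.fit m k u d) Ψ (d i) - (Ψ' - Ψ) :=
    fun k i => eif_sub t q (C.fit m k u d) Ψ Ψ' (d i)
  rw [Finset.sum_congr rfl fun k _ => Finset.sum_congr rfl fun i _ => e k i]
  rw [Finset.sum_congr rfl fun k _ => Finset.sum_sub_distrib _ _, Finset.sum_sub_distrib,
    C.sum_sum_fold m u fun _ => Ψ' - Ψ, mul_sub]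
  simp only [Finset.sum_const, Finset.card_univ, Fintype.card_fin, nsmul_eq_mul]
  field_simp

lemma CrossFit.measurable_eif_fit {K : ℕ} (C : CrossFit K p 𝒰 𝒴 𝒵) (t : Fin 2) (q Ψ : ℝ) (m : ℕ)
    (k : Fin K) :
    Measurable fun x : (𝒰 × (Fin (K * m) → Obs 𝒴 𝒵)) × Obs 𝒴 𝒵 =>
      eif t q (C.fit m k x.1.1 x.1.2) Ψ x.2 := by
  have e1 : Measurable fun x : (𝒰 × (Fin (K * m) → Obs 𝒴 𝒵)) × 𝒴 × 𝒵 =>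
      (x.1.1, x.1.2, x.2) := by fun_prop
  have e2 : Measurable fun x : (𝒰 × (Fin (K * m) → Obs 𝒴 𝒵)) × 𝒵 =>
      (x.1.1, x.1.2, x.2) := by fun_prop
  exact measurable_eif (η := fun x : 𝒰 × (Fin (K * m) → Obs 𝒴 𝒵) => C.fit m k x.1 x.2) t q Ψ
    ((C.measurable_score m k).comp e1) ((C.measurable_outcome m k).comp e1)
    ((C.measurable_propensity m k).comp e2) ((C.measurable_mbar m k).comp e2)

lemma CrossFit.measurable_estimatingFn {K : ℕ} (C : CrossFit K p 𝒰 𝒴 𝒵) (t : Fin 2) (q Ψ : ℝ)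
    (m : ℕ) : Measurable fun x : 𝒰 × (Fin (K * m) → Obs 𝒴 𝒵) =>
      C.estimatingFn t q m x.1 x.2 Ψ := by
  refine (Finset.measurable_sum _ fun k _ => ?_).const_mul _
  have : (fun x : 𝒰 × (Fin (K * m) → Obs 𝒴 𝒵) =>
      ∑ i ∈ Finset.univ.filter (fun i => C.fold m x.1 i = k),
        eif t q (C.fit m k x.1 x.2) Ψ (x.2 i)) = fun x =>
      ∑ i, {x : 𝒰 × (Fin (K * m) → Obs 𝒴 𝒵) | C.fold m x.1 i = k}.indicator
        (fun x => eif t q (C.fit m k x.1 x.2) Ψ (x.2 i)) x := by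
    ext x
    simp [Set.indicator_apply, Finset.sum_filter]
  rw [this]
  refine Finset.measurable_sum _ fun i _ => Measurable.indicator ?_
    ((C.measurable_fold m i).comp measurable_fst (measurableSet_singleton k))
  have hid : Measurable fun x : 𝒰 × (Fin (K * m) → Obs 𝒴 𝒵) => (x, x.2 i) :=
    measurable_id.prodMk ((measurable_pi_apply i).comp measurable_snd)
  have hcomp := (C.measurable_eif_fit t q Ψ m k).comp hid
  simpa only [Function.comp_def] using hcomp

lemma IsAdmissible.measurable_eif {P : Measure Ω} {X : Sample Ω 𝒴 𝒵} {c : ℝ} {η : Nuisance p 𝒴 𝒵}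
    (ha : IsAdmissible P X c η) (t : Fin 2) (q Ψ : ℝ) :
    Measurable fun o => eif t q η Ψ o := by
  have h := SRI.measurable_eif (η := fun _ : Unit => η) t q Ψ
    (ha.measurable_score.comp measurable_snd) (ha.measurable_outcome.comp measurable_snd)
    (ha.measurable_propensity.comp measurable_snd) (ha.measurable_mbar.comp measurable_snd)
  have hid : Measurable fun o : Obs 𝒴 𝒵 => ((), o) := measurable_prodMk_left
  have hcomp := h.comp hid
  simpa only [Function.comp_def] using hcomp

lemma Sample.IsIID.measurable_data {P : Measure Ω} {X : Sample Ω 𝒴 𝒵} (hiid : X.IsIID P)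
    (n : ℕ) : Measurable (X.data n) :=
  measurable_pi_lambda _ fun i => hiid.measurable_obs i

variable {P : Measure Ω} [IsProbabilityMeasure P] {X : Sample Ω 𝒴 𝒵} {t : Fin 2} {c : ℝ}
  {η : Nuisance p 𝒴 𝒵}

/-- Accurate estimates of the nuisance functions give an estimated influence function that is close
to the true one, in `L²` and, at the rate `n^{-1/2}`, in mean. -/
theorem IsIdentified.exists_smallMoments (h : IsIdentified P X t c η)
    (hobs : Measurable (X.obs 0)) {ε : ℝ} (hε : 0 < ε) :
    ∃ δ₀ > 0, ∀ (n : ℕ) (δ : ℝ) (ηh : Nuisance p 𝒴 𝒵), δ ≤ δ₀ →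
      (Measurable fun x : 𝒴 × 𝒵 => ηh.score x.1 x.2) →
      (Measurable fun x : 𝒴 × 𝒵 => ηh.outcome x.1 x.2) → Measurable ηh.π → Measurable ηh.mbar →
      (∀ᵐ ω ∂P, ηh.score (X.Y 0 ω) (X.Z 0 ω) ∈ Set.Icc (0 : ℝ) 1) →
      (∀ᵐ ω ∂P, ηh.π (X.Z 0 ω) ∈ Set.Icc c 1) →
      Accurate P X η ηh n δ →
      SmallMoments (P.map (X.obs 0)) n (ENNReal.ofReal ε) fun o =>
        eif t (P.real {ω | X.S 0 ω = 1}) ηh (target P X t) o -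
          eif t (P.real {ω | X.S 0 ω = 1}) η (target P X t) o := by
  have hc := h.c_pos
  have hZ := h.measurable_Z
  have hYZ : Measurable fun ω => (X.Y 0 ω, X.Z 0 ω) := h.measurable_Y.prodMk hZ
  have hq0 := h.annotated_pos
  set q := P.real {ω | X.S 0 ω = 1}
  set κ : ℝ := (q * c)⁻¹ + c⁻¹ + 1 + c⁻¹ ^ 2
  have hκ0 : 0 < κ := by positivity
  set G : Ω → ℝ := fun ω => η.outcome (X.Y 0 ω) (X.Z 0 ω) - η.mbar (X.Z 0 ω)
  have hGm : StronglyMeasurable G := ((h.admissible.measurable_outcome.comp hYZ).sub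
    (h.admissible.measurable_mbar.comp hZ)).stronglyMeasurable
  have hG2 : MemLp G 2 P := h.admissible.memLp_outcome.sub h.admissible.memLp_mbar
  obtain ⟨M, hM0, hM⟩ := hG2.eLpNorm_indicator_norm_ge_pos_le hGm
    (show 0 < ε / (2 * κ) by positivity)
  refine ⟨min (ε / (2 * κ * (2 + M))) (c * ε / 2), by positivity, ?_⟩
  intro n δ ηh hδ hρ hμ hπ hm hρb hπb hacc
  have hδ1 : δ ≤ ε / (2 * κ * (2 + M)) := hδ.trans (min_le_left _ _)
  have hδ2 : δ ≤ c * ε / 2 := hδ.trans (min_le_right _ _)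
  -- `δ` may be negative, in which case the errors vanish
  set δ' := max δ 0 with hδ'
  have hδ'0 : 0 ≤ δ' := le_max_right _ _
  have hofδ : ENNReal.ofReal δ = ENNReal.ofReal δ' := by
    rcases le_total δ 0 with h0 | h0
    · rw [hδ', max_eq_right h0, ENNReal.ofReal_of_nonpos h0, ENNReal.ofReal_zero]
    · rw [hδ', max_eq_left h0]
  have hδ1' : δ' ≤ ε / (2 * κ * (2 + M)) := max_le hδ1 (by positivity)
  have hδ2' : δ' ≤ c * ε / 2 := max_le hδ2 (by positivity)
  have ha : IsAdmissible P X c ηh :=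
    { measurable_score := hρ
      measurable_outcome := hμ
      measurable_propensity := hπ
      measurable_mbar := hm
      memLp_outcome := by
        have h1 : MemLp (fun ω => ηh.outcome (X.Y 0 ω) (X.Z 0 ω) -
            η.outcome (X.Y 0 ω) (X.Z 0 ω)) 2 P :=
          ⟨((hμ.sub h.admissible.measurable_outcome).comp hYZ).aestronglyMeasurable,
            hacc.outcome.trans_lt ENNReal.ofReal_lt_top⟩
        exact (memLp_congr_ae (.of_forall fun ω => by simp)).mp (h1.add h.admissible.memLp_outcome)
      memLp_mbar := by
        have h1 : MemLp (fun ω => ηh.mbar (X.Z 0 ω) - η.mbar (X.Z 0 ω)) 2 P :=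
          ⟨((hm.sub h.admissible.measurable_mbar).comp hZ).aestronglyMeasurable,
            hacc.mbar.trans_lt ENNReal.ofReal_lt_top⟩
        exact (memLp_congr_ae (.of_forall fun ω => by simp)).mp (h1.add h.admissible.memLp_mbar)
      score_mem := hρb
      propensity_mem := hπb }
  have hdm : Measurable fun o => eif t q ηh (target P X t) o - eif t q η (target P X t) o :=
    (ha.measurable_eif t q _).sub (h.admissible.measurable_eif t q _)
  constructor
  · rw [lintegral_map (hdm.enorm.pow_const 2) hobs]
    have hle := h.eLpNorm_eif_sub_le ha (target P X t) hM0.le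
    have hfin : eLpNorm (fun ω => eif t q ηh (target P X t) (X.obs 0 ω) -
        eif t q η (target P X t) (X.obs 0 ω)) 2 P ≤ ENNReal.ofReal ε := by
      refine hle.trans ?_
      calc _ ≤ ENNReal.ofReal κ * (ENNReal.ofReal δ' + ENNReal.ofReal δ' +
            ENNReal.ofReal M * ENNReal.ofReal δ' + ENNReal.ofReal (ε / (2 * κ))) := by
            rw [← hofδ]
            gcongr
            · exact hacc.outcome
            · exact hacc.mbar
            · exact hacc.propensity
        _ = ENNReal.ofReal (κ * (δ' + δ' + M * δ' + ε / (2 * κ))) := by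
            rw [← ENNReal.ofReal_mul hM0.le, ← ENNReal.ofReal_add hδ'0 hδ'0,
              ← ENNReal.ofReal_add (by positivity) (by positivity),
              ← ENNReal.ofReal_add (by positivity) (by positivity), ← ENNReal.ofReal_mul hκ0.le]
        _ ≤ ENNReal.ofReal ε := by
            refine ENNReal.ofReal_le_ofReal ?_
            rw [le_div_iff₀ (by positivity)] at hδ1'
            have : κ * (ε / (2 * κ)) = ε / 2 := by field_simp
            nlinarith
    have hsq : ∫⁻ ω, ‖eif t q ηh (target P X t) (X.obs 0 ω) -
        eif t q η (target P X t) (X.obs 0 ω)‖ₑ ^ 2 ∂P =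
        eLpNorm (fun ω => eif t q ηh (target P X t) (X.obs 0 ω) -
          eif t q η (target P X t) (X.obs 0 ω)) 2 P ^ 2 := by
      rw [eLpNorm_eq_lintegral_rpow_enorm_toReal two_ne_zero ENNReal.ofNat_ne_top]
      simp only [ENNReal.toReal_ofNat, ENNReal.rpow_ofNat, one_div]
      rw [← ENNReal.rpow_ofNat, ← ENNReal.rpow_mul]
      simp
    exact hsq.trans_le (pow_le_pow_left' hfin 2)
  · rw [integral_map hobs.aemeasurable hdm.aestronglyMeasurable,
      integral_sub (h.integral_eif ha).1 (h.integral_eif h.admissible).1,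
      h.integral_eif_eq_zero, sub_zero]
    calc _ ≤ ENNReal.ofReal √n * (ENNReal.ofReal c⁻¹ *
          (l2dist P X ηh.score η.score * l2dist P X ηh.outcome η.outcome +
            l2dist P X (fun _ => ηh.π) (fun _ => η.π) *
              l2dist P X (fun _ => ηh.mbar) (fun _ => η.mbar))) := by
          gcongr
          exact h.enorm_integral_eif_le ha
      _ = ENNReal.ofReal c⁻¹ * (ENNReal.ofReal √n *
          (l2dist P X ηh.score η.score * l2dist P X ηh.outcome η.outcome) +
            ENNReal.ofReal √n * (l2dist P X (fun _ => ηh.π) (fun _ => η.π) *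
              l2dist P X (fun _ => ηh.mbar) (fun _ => η.mbar))) := by ring
      _ ≤ ENNReal.ofReal c⁻¹ * (ENNReal.ofReal δ' + ENNReal.ofReal δ') := by
          rw [← hofδ]
          gcongr
          · exact hacc.score_mul_outcome
          · exact hacc.propensity_mul_mbar
      _ = ENNReal.ofReal (c⁻¹ * (δ' + δ')) := by
          rw [← ENNReal.ofReal_add hδ'0 hδ'0, ← ENNReal.ofReal_mul (by positivity)]
      _ ≤ ENNReal.ofReal ε := by
          refine ENNReal.ofReal_le_ofReal ?_
          rw [inv_mul_le_iff₀ hc]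
          linarith

lemma Sample.IsIID.map_data (hiid : X.IsIID P) (n : ℕ) :
    P.map (X.data n) = Measure.pi fun _ => P.map (X.obs 0) := by
  have h1 : iIndepFun (fun (i : Fin n) => X.obs i) P := hiid.indep.precomp Fin.val_injective
  have h2 := (iIndepFun_iff_map_fun_eq_pi_map fun i : Fin n =>
    (hiid.measurable_obs i).aemeasurable).mp h1
  refine Eq.trans h2 ?_
  congr 1
  ext1 i
  exact (hiid.identDistrib i).map_eq

/-- Within each fold, estimating the nuisance functions changes the normalised sum of influence
functions by a quantity that tends to zero in probability. -/
theorem IsIdentified.tendsto_measure_fold (h : IsIdentified P X t c η) (hiid : X.IsIID P)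
    {K : ℕ} (hK : 1 ≤ K) (C : CrossFit K p 𝒰 𝒴 𝒵) {U : ℕ → Ω → 𝒰}
    (hU : ∀ m, Measurable (U m)) (hU_indep : ∀ m, IndepFun (U m) (X.data (K * m)) P)
    (hpos_est : ∀ m k, ∀ᵐ ω ∂P, ∀ᵐ ω' ∂P,
      (C.fit m k (U m ω) (X.data (K * m) ω)).π (X.Z 0 ω') ∈ Set.Icc c 1)
    (hscore_est : ∀ m k, ∀ᵐ ω ∂P, ∀ᵐ ω' ∂P,
      (C.fit m k (U m ω) (X.data (K * m) ω)).score (X.Y 0 ω') (X.Z 0 ω') ∈ Set.Icc (0 : ℝ) 1)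
    {δ : ℕ → ℝ} (hδ : Tendsto δ atTop (𝓝 0)) (k : Fin K)
    (hrate : Tendsto (fun m => P {ω | ¬ Accurate P X η
      (C.fit m k (U m ω) (X.data (K * m) ω)) (K * m) (δ (K * m))}) atTop (𝓝 0))
    {r : ℝ} (hr : 0 < r) :
    Tendsto (fun m => P {ω | ENNReal.ofReal (r * √((K * m : ℕ) : ℝ)) ≤
      ‖∑ i ∈ Finset.univ.filter (fun i => C.fold m (U m ω) i = k),
        (eif t (P.real {ω | X.S 0 ω = 1}) (C.fit m k (U m ω) (X.data (K * m) ω)) (target P X t)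
            (X.data (K * m) ω i) -
          eif t (P.real {ω | X.S 0 ω = 1}) η (target P X t) (X.data (K * m) ω i))‖ₑ})
      atTop (𝓝 0) := by
  have hobs := hiid.measurable_obs 0
  have : IsProbabilityMeasure (P.map (X.obs 0)) := Measure.isProbabilityMeasure_map hobs.aemeasurable
  set q := P.real {ω | X.S 0 ω = 1}
  set Ψ := target P X t
  rw [ENNReal.tendsto_nhds_zero]
  intro e he
  -- the second moments are small enough for Chebyshev's inequality to give a bound by `e / 2`
  obtain ⟨ε, hε, hεe⟩ : ∃ ε : ℝ, 0 < ε ∧ 2 * ENNReal.ofReal ε ^ 2 / ENNReal.ofReal r ^ 2 ≤ e / 2 := by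
    have hlim : Tendsto (fun ε : ℝ => 2 * ENNReal.ofReal ε ^ 2 / ENNReal.ofReal r ^ 2)
        (𝓝[>] 0) (𝓝 0) := by
      have h1 : Tendsto (fun ε : ℝ => ENNReal.ofReal (2 * ε ^ 2 / r ^ 2)) (𝓝[>] 0) (𝓝 0) := by
        have : Continuous fun ε : ℝ => ENNReal.ofReal (2 * ε ^ 2 / r ^ 2) :=
          ENNReal.continuous_ofReal.comp (by fun_prop)
        simpa using (this.tendsto 0).mono_left nhdsWithin_le_nhds
      refine h1.congr' ?_
      filter_upwards [self_mem_nhdsWithin] with ε hε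
      rw [ENNReal.ofReal_div_of_pos (by positivity), ENNReal.ofReal_mul (by norm_num),
        ENNReal.ofReal_pow (le_of_lt hε), ENNReal.ofReal_pow hr.le, ENNReal.ofReal_ofNat]
    have h2 := (ENNReal.tendsto_nhds_zero.mp hlim (e / 2) (ENNReal.half_pos he.ne')).and
      self_mem_nhdsWithin
    obtain ⟨ε, h3, h4⟩ := h2.exists
    exact ⟨ε, h4, h3⟩
  obtain ⟨δ₀, hδ₀, hsmall⟩ := h.exists_smallMoments hobs hε
  have hKm : Tendsto (fun m => K * m) atTop atTop :=
    Filter.tendsto_id.const_mul_atTop' (by omega)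
  filter_upwards [(hδ.comp hKm).eventually_le_const hδ₀,
    ENNReal.tendsto_nhds_zero.mp hrate (e / 2) (ENNReal.half_pos he.ne'),
    Filter.eventually_ge_atTop 1] with m hm1 hm2 hm3
  have hn : 0 < K * m := Nat.mul_pos hK hm3
  set g : 𝒰 → (Fin (K * m) → Obs 𝒴 𝒵) → Obs 𝒴 𝒵 → ℝ := fun u d o =>
    eif t q (C.fit m k u d) Ψ o - eif t q η Ψ o with hg
  have hηm : Measurable fun o => eif t q η Ψ o := h.admissible.measurable_eif t q Ψ
  have hgm : Measurable fun x : (𝒰 × (Fin (K * m) → Obs 𝒴 𝒵)) × Obs 𝒴 𝒵 => g x.1.1 x.1.2 x.2 :=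
    (C.measurable_eif_fit t q Ψ m k).sub (hηm.comp measurable_snd)
  set J : 𝒰 → Finset (Fin (K * m)) := fun u => Finset.univ.filter fun i => C.fold m u i = k with hJ
  have hr0 : 0 < r * √((K * m : ℕ) : ℝ) := by positivity
  have hJm : ∀ i, MeasurableSet {u | i ∈ J u} := fun i => by
    have : {u | i ∈ J u} = (fun u => C.fold m u i) ⁻¹' {k} := by ext u; simp [hJ]
    rw [this]
    exact C.measurable_fold m i (measurableSet_singleton k)
  have hgout : ∀ u d d', (∀ i ∉ J u, d i = d' i) → g u d = g u d' := fun u d d' hd => by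
    have : C.fit m k u d = C.fit m k u d' :=
      C.fit_out_of_fold m k u d d' fun i hi => hd i (by simpa [hJ] using hi)
    simp only [hg, this]
  have hνprob : IsProbabilityMeasure (P.map (U m)) :=
    Measure.isProbabilityMeasure_map (hU m).aemeasurable
  have hprod := prod_measure_sum_fold_le (Q := P.map (X.obs 0)) (ν := P.map (U m)) J hJm hgm hgout
    (v := ENNReal.ofReal ε) ENNReal.ofReal_ne_top
    (r := ENNReal.ofReal (r * √((K * m : ℕ) : ℝ))) (by simpa using hr0) ENNReal.ofReal_ne_top
  have hpair : Measurable fun ω => (U m ω, X.data (K * m) ω) :=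
    (hU m).prodMk (hiid.measurable_data _)
  have hlaw : P.map (fun ω => (U m ω, X.data (K * m) ω)) =
      (P.map (U m)).prod (Measure.pi fun _ => P.map (X.obs 0)) := by
    rw [(indepFun_iff_map_prod_eq_prod_map_map (hU m).aemeasurable
      (hiid.measurable_data _).aemeasurable).mp (hU_indep m), hiid.map_data]
  rw [← hlaw] at hprod
  have hgood := (Measure.le_map_apply hpair.aemeasurable _).trans hprod
  have hbound : 2 * ((K * m : ℕ) : ENNReal) * ENNReal.ofReal ε ^ 2 /
      ENNReal.ofReal (r * √((K * m : ℕ) : ℝ)) ^ 2 ≤ e / 2 := by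
    refine le_trans (le_of_eq ?_) hεe
    have hn0 : ((K * m : ℕ) : ENNReal) ≠ 0 := Nat.cast_ne_zero.mpr hn.ne'
    have hsq : ENNReal.ofReal √((K * m : ℕ) : ℝ) ^ 2 = ((K * m : ℕ) : ENNReal) := by
      rw [← ENNReal.ofReal_pow (Real.sqrt_nonneg _), Real.sq_sqrt (Nat.cast_nonneg _),
        ENNReal.ofReal_natCast]
    rw [ENNReal.ofReal_mul hr.le, mul_pow, hsq, mul_right_comm,
      ENNReal.mul_div_mul_right _ _ hn0 (ENNReal.natCast_ne_top _)]
  have hae : {ω | ENNReal.ofReal (r * √((K * m : ℕ) : ℝ)) ≤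
      ‖∑ i ∈ J (U m ω), g (U m ω) (X.data (K * m) ω) (X.data (K * m) ω i)‖ₑ} ≤ᵐ[P]
      ({ω | ¬ Accurate P X η (C.fit m k (U m ω) (X.data (K * m) ω)) (K * m) (δ (K * m))} ∪
        (fun ω => (U m ω, X.data (K * m) ω)) ⁻¹'
          {x | SmallMoments (P.map (X.obs 0)) (K * m) (ENNReal.ofReal ε) (g x.1 x.2) ∧
            ENNReal.ofReal (r * √((K * m : ℕ) : ℝ)) ≤
              ‖∑ i ∈ J x.1, g x.1 x.2 (x.2 i)‖ₑ} : Set Ω) := by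
    filter_upwards [hpos_est m k, hscore_est m k] with ω h1 h2 hω
    by_cases hacc : Accurate P X η (C.fit m k (U m ω) (X.data (K * m) ω)) (K * m) (δ (K * m))
    · refine Or.inr ⟨?_, hω⟩
      have e1 : Measurable fun x : 𝒴 × 𝒵 => (U m ω, X.data (K * m) ω, x.1, x.2) := by fun_prop
      have e2 : Measurable fun z : 𝒵 => (U m ω, X.data (K * m) ω, z) := by fun_prop
      exact hsmall (K * m) (δ (K * m)) (C.fit m k (U m ω) (X.data (K * m) ω)) hm1
        ((C.measurable_score m k).comp e1) ((C.measurable_outcome m k).comp e1)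
        ((C.measurable_propensity m k).comp e2) ((C.measurable_mbar m k).comp e2) h2 h1 hacc
    · exact Or.inl hacc
  calc _ ≤ _ := measure_mono_ae hae
    _ ≤ e / 2 + e / 2 := (measure_union_le _ _).trans (add_le_add hm2 (hgood.trans hbound))
    _ = e := ENNReal.add_halves e

end Estimation

end SRI

/-! ### Asymptotic normality -/

theorem theorem2 {Ω 𝒴 𝒵 𝒰 : Type*} [MeasurableSpace Ω] [MeasurableSpace 𝒴] [MeasurableSpace 𝒵]
    [MeasurableSpace 𝒰] (P : Measure Ω) [IsProbabilityMeasure P]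
    -- i.i.d. units
    (X : SRI.Sample Ω 𝒴 𝒵) (hiid : X.IsIID P)
    -- true coding rule, perfect annotations, random annotation sampling
    (gL : 𝒴 → ℝ) (hgL : Measurable gL) (hL : ∀ i ω, X.L i ω = gL (X.Y i ω))
    (hperfect : ∀ i, ∀ᵐ ω ∂P, X.Lt i ω = X.L i ω)
    (hS : IndepFun (fun ω => (X.T 0 ω, X.Y 0 ω, X.Z 0 ω)) (X.S 0) P)
    (hS_pos : 0 < P {ω | X.S 0 ω = 1})
    -- sufficient representation and the population nuisance functions at level `t`
    (t : Fin 2) {p : ℕ} (η : SRI.Nuisance p 𝒴 𝒵) (hη : SRI.IsPopulationNuisance P X t η)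
    -- cross-fitting with auxiliary randomness independent of the sample
    {K : ℕ} (hK : 1 ≤ K) (C : SRI.CrossFit K p 𝒰 𝒴 𝒵) (U : ℕ → Ω → 𝒰)
    (hU : ∀ m, Measurable (U m)) (hU_indep : ∀ m, IndepFun (U m) (X.data (K * m)) P)
    -- bounded second moment
    (hmom : MemLp (X.Lt 0) 2 P)
    -- positivity
    (c₂ : ℝ) (hc₂ : c₂ ∈ Set.Ioc (0 : ℝ) (1 / 2))
    (hpos : ∀ᵐ ω ∂P, η.π (X.Z 0 ω) ∈ Set.Icc c₂ (1 - c₂))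
    (hpos_est : ∀ m k, ∀ᵐ ω ∂P, ∀ᵐ ω' ∂P,
      (C.fit m k (U m ω) (X.data (K * m) ω)).π (X.Z 0 ω') ∈ Set.Icc c₂ (1 - c₂))
    (hscore_est : ∀ m k, ∀ᵐ ω ∂P, ∀ᵐ ω' ∂P,
      (C.fit m k (U m ω) (X.data (K * m) ω)).score (X.Y 0 ω') (X.Z 0 ω') ∈ Set.Icc (0 : ℝ) 1)
    -- consistency and product rates of the estimated nuisance functions
    (δ : ℕ → ℝ) (hδ : Tendsto δ atTop (𝓝 0))
    (hrate : ∀ k, Tendsto (fun m => P {ω | ¬ SRI.Accurate P X η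
      (C.fit m k (U m ω) (X.data (K * m) ω)) (K * m) (δ (K * m))}) atTop (𝓝 0))
    -- the estimator solves the estimating equation
    (Ψhat : ℕ → Ω → ℝ)
    (hΨhat : ∀ m, ∀ᵐ ω ∂P, C.estimatingFn t (P.real {ω | X.S 0 ω = 1}) m (U m ω)
      (X.data (K * m) ω) (Ψhat m ω) = 0)
    -- nondegenerate limit
    (hσ : 0 < SRI.asymVar P X t η) :
    TendstoInDistribution
      (fun m ω => √((K * m : ℕ) : ℝ) * (Ψhat m ω - SRI.target P X t) / √(SRI.asymVar P X t η))
      atTop (id : ℝ → ℝ) (fun _ => P) (gaussianReal 0 1) := by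
  obtain ⟨hc, -⟩ := hc₂
  have h : SRI.IsIdentified P X t c₂ η := hη.isIdentified hiid hgL (hL 0) (hperfect 0) hS hS_pos
    hmom hc hpos
  set q := P.real {ω | X.S 0 ω = 1}
  set Ψ := SRI.target P X t
  set σ := √(SRI.asymVar P X t η)
  have hσ0 : 0 < σ := Real.sqrt_pos.mpr hσ
  have hψm : Measurable fun o => SRI.eif t q η Ψ o := h.admissible.measurable_eif t q Ψ
  -- the central limit theorem for the standardised influence functions, along multiples of `K`
  set ψ : ℕ → Ω → ℝ := fun i ω => SRI.eif t q η Ψ (X.obs i ω) / σ with hψ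
  have hψind : iIndepFun ψ P :=
    hiid.indep.comp (fun _ o => SRI.eif t q η Ψ o / σ) fun _ => hψm.div_const σ
  have hψid : ∀ i, IdentDistrib (ψ i) (ψ 0) P P := fun i =>
    (hiid.identDistrib i).comp (hψm.div_const σ)
  have hmean : P[ψ 0] = 0 := by
    have h0 : ∫ ω, SRI.eif t q η Ψ (X.obs 0 ω) ∂P = 0 := h.integral_eif_eq_zero
    simp only [hψ]
    rw [integral_div, h0, zero_div]
  -- `σ` is positive, so this second moment is not the default value of a divergent integral
  have hvar : P[ψ 0 ^ 2] = 1 := by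
    have h1 : ∫ ω, SRI.eif t q η Ψ (X.obs 0 ω) ^ 2 ∂P = σ ^ 2 := (Real.sq_sqrt hσ.le).symm
    have h2 : ∀ ω, (ψ 0 ^ 2) ω = SRI.eif t q η Ψ (X.obs 0 ω) ^ 2 / σ ^ 2 := fun ω => by
      simp [hψ, div_pow]
    simp_rw [h2]
    rw [integral_div, h1, div_self (by positivity)]
  have hclt := tendstoInDistribution_inv_sqrt_mul_sum (HasLaw.id (μ := gaussianReal 0 1))
    hmean hvar hψind hψid
  have hKm : Tendsto (fun m => K * m) atTop atTop :=
    Filter.tendsto_id.const_mul_atTop' (by omega)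
  have hcltK : TendstoInDistribution
      (fun (m : ℕ) ω => (√((K * m : ℕ) : ℝ))⁻¹ * ∑ i ∈ Finset.range (K * m), ψ i ω) atTop
      (id : ℝ → ℝ) (fun _ => P) (gaussianReal 0 1) :=
    ⟨fun m => hclt.forall_aemeasurable (K * m), hclt.aemeasurable_limit, hclt.tendsto.comp hKm⟩
  -- the estimating equation is affine, so that its solution is explicit
  have hest : ∀ m, (fun ω => √((K * m : ℕ) : ℝ) *
        C.estimatingFn t q m (U m ω) (X.data (K * m) ω) Ψ / σ) =ᵐ[P]
      fun ω => √((K * m : ℕ) : ℝ) * (Ψhat m ω - Ψ) / σ := by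
    intro m
    filter_upwards [hΨhat m] with ω hω
    rcases eq_or_ne (K * m) 0 with h0 | h0
    · -- for `n = 0` the equation is void, but the factor `√n` vanishes
      simp [h0]
    · rw [C.estimatingFn_sub t q h0 _ _ Ψ, sub_eq_zero] at hω
      rw [hω]
  refine TendstoInDistribution.congr hest (ae_eq_refl _) ?_
  have hdata := fun m => hiid.measurable_data (K * m)
  refine tendstoInDistribution_of_tendstoInMeasure_sub _ _ hcltK ?_ fun m =>
    ((((C.measurable_estimatingFn t q Ψ m).comp ((hU m).prodMk (hdata m))).const_mul _).div_const
      σ).aemeasurable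
  -- the effect of estimating the nuisance functions is negligible, fold by fold
  set R : Fin K → ℕ → Ω → ℝ := fun k m ω =>
    ∑ i ∈ Finset.univ.filter (fun i => C.fold m (U m ω) i = k),
      (SRI.eif t q (C.fit m k (U m ω) (X.data (K * m) ω)) Ψ (X.data (K * m) ω i) -
        SRI.eif t q η Ψ (X.data (K * m) ω i)) with hR
  have hdiff : ∀ m ω, √((K * m : ℕ) : ℝ) *
      C.estimatingFn t q m (U m ω) (X.data (K * m) ω) Ψ / σ -
        (√((K * m : ℕ) : ℝ))⁻¹ * ∑ i ∈ Finset.range (K * m), ψ i ω =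
      (√((K * m : ℕ) : ℝ) * σ)⁻¹ * ∑ k, R k m ω := by
    intro m ω
    have h1 : ∑ i ∈ Finset.range (K * m), ψ i ω =
        (∑ k : Fin K, ∑ i ∈ Finset.univ.filter (fun i => C.fold m (U m ω) i = k),
          SRI.eif t q η Ψ (X.data (K * m) ω i)) / σ := by
      rw [C.sum_sum_fold m (U m ω) fun i => SRI.eif t q η Ψ (X.data (K * m) ω i),
        Finset.sum_range, Finset.sum_div]
      rfl
    have h2 : √((K * m : ℕ) : ℝ) * (1 / ((K * m : ℕ) : ℝ)) = (√((K * m : ℕ) : ℝ))⁻¹ := by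
      rw [mul_one_div, Real.sqrt_div_self]
    rw [h1]
    simp only [hR, Finset.sum_sub_distrib, SRI.CrossFit.estimatingFn]
    rw [← mul_assoc, h2, mul_inv]
    ring
  rw [tendstoInMeasure_iff_norm]
  intro r hr
  have hK0 : (0 : ℝ) < K := by exact_mod_cast hK
  have hfold : ∀ k, Tendsto (fun m => P {ω | ENNReal.ofReal (r * σ / K * √((K * m : ℕ) : ℝ)) ≤
      ‖R k m ω‖ₑ}) atTop (𝓝 0) := fun k =>
    h.tendsto_measure_fold hiid hK C hU hU_indep
      (fun m k => (hpos_est m k).mono fun ω h' => h'.mono fun ω' h'' =>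
        ⟨h''.1, h''.2.trans (by linarith)⟩)
      hscore_est hδ k (hrate k) (by positivity)
  have hsum : Tendsto (fun m => ∑ k, P {ω | ENNReal.ofReal (r * σ / K * √((K * m : ℕ) : ℝ)) ≤
      ‖R k m ω‖ₑ}) atTop (𝓝 0) := by
    simpa using tendsto_finsetSum Finset.univ fun k _ => hfold k
  refine tendsto_of_tendsto_of_tendsto_of_le_of_le' tendsto_const_nhds hsum
    (.of_forall fun _ => zero_le) ?_
  filter_upwards [eventually_ge_atTop 1] with m hm
  have hn : (0 : ℝ) < √((K * m : ℕ) : ℝ) :=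
    Real.sqrt_pos.mpr (Nat.cast_pos.mpr (Nat.mul_pos hK hm))
  refine (measure_mono fun ω hω => ?_).trans (measure_iUnion_fintype_le P _)
  have hω' : r ≤ ‖(√((K * m : ℕ) : ℝ) * σ)⁻¹ * ∑ k, R k m ω‖ := by
    rw [← hdiff m ω]
    simpa using! hω
  by_contra hcon
  simp only [Set.mem_iUnion, not_exists] at hcon
  have hlt : ∀ k, |R k m ω| < r * σ / K * √((K * m : ℕ) : ℝ) := fun k => by
    have h1 : ‖R k m ω‖ₑ < ENNReal.ofReal (r * σ / K * √((K * m : ℕ) : ℝ)) :=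
      not_le.mp (hcon k)
    rw [← ofReal_norm, ENNReal.ofReal_lt_ofReal_iff (by positivity)] at h1
    exact h1
  have : Nonempty (Fin K) := ⟨⟨0, hK⟩⟩
  have h1 : |∑ k, R k m ω| < r * σ * √((K * m : ℕ) : ℝ) := by
    calc |∑ k, R k m ω| ≤ ∑ k, |R k m ω| := Finset.abs_sum_le_sum_abs _ _
      _ < ∑ _k : Fin K, r * σ / K * √((K * m : ℕ) : ℝ) :=
          Finset.sum_lt_sum_of_nonempty Finset.univ_nonempty fun k _ => hlt k
      _ = r * σ * √((K * m : ℕ) : ℝ) := by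
          simp only [Finset.sum_const, Finset.card_univ, Fintype.card_fin, nsmul_eq_mul]
          field_simp
  rw [norm_mul, norm_inv, Real.norm_eq_abs, Real.norm_eq_abs,
    abs_of_pos (mul_pos hn hσ0), inv_mul_eq_div, le_div_iff₀ (mul_pos hn hσ0)] at hω'
  linarith
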